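/- Let $N\ge 2$ robots be connected in an all-to-all topology, with initial headings $\theta_1(0),\dots,\theta_N(0)\in[0,2\pi)$ that are pairwise distinct. Let $\omega_0>0$, $\omega_{\max}>0$ and let $l_1,l_2\in[0,1)$ be not both zero. Each robot $i$ has a phase variable $\phi_i$ with $\phi_i(0)=\theta_i(0)$ and rate $\dot\phi_i=\omega_i$, where initially $\omega_i=\omega_0$. When $\phi_i$ reaches $2\pi$, robot $i$ fires: it resets $\phi_i$ to $0$, drops any unfinished phase adjustment (returning to $\omega_i=\omega_0$), and sends a pulse that all other robots receive at once. A robot that receives a pulse computes from its current phase, in place of any unfinished adjustment, a new phase adjustment $\psi_i=F(\phi_i)$, where $$F(\phi)=\begin{cases} l_1\left(\frac{2\pi}{N}-\phi\right) & 0<\phi<\frac{2\pi}{N},\\ 0 & \frac{2\pi}{N}\le\phi\le 2\pi\frac{N-1}{N},\\ l_2\left(2\pi\frac{N-1}{N}-\phi\right) & 2\pi\frac{N-1}{N}<\phi<2\pi.\end{cases}$$ It then runs at rate $\omega_i=\omega_0+\operatorname{sgn}(\psi_i)\,\omega_{\max}$ for the time $\tau_i=|\psi_i|/\omega_{\max}$,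 or until it fires or receives a further pulse if that happens earlier; after the time $\tau_i$ it returns to $\omega_i=\omega_0$. The headings follow the control $\dot\theta_i=\dot\phi_i-\omega_0$, where $\dot\phi_i$ means the rate $\omega_i$. Then such an evolution exists for all times $t\ge 0$. In every such evolution the headings satisfy the rate constraint $|\dot\theta_i|\le\omega_{\max}$ (they are Lipschitz in time with constant $\omega_{\max}$) and converge to desynchronization: if the robots are numbered so that $\theta_1(0)>\theta_2(0)>\dots>\theta_N(0)$, then, with $\theta_{N+1}:=\theta_1$, $$\lim_{t\to\infty}\bigl[(\theta_i(t)-\theta_{i+1}(t))\bmod 2\pi\bigr]=\frac{2\pi}{N}\qquad\text{for all } i=1,\dots,N.$$ -/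

import Mathlib

open Filter Topology

namespace HeadingDesync

/-- The phase response function with forward coupling strength `l₁` and backward coupling
strength `l₂`: the phase adjustment `ψ = F(φ)` requested of a robot whose phase is `φ` when it
receives a pulse. -/
noncomputable def phaseResponse (N : ℕ) (l₁ l₂ φ : ℝ) : ℝ :=
  if 0 < φ ∧ φ < 2 * Real.pi / N then
    l₁ * (2 * Real.pi / N - φ)
  else if 2 * Real.pi * ((N - 1) / N) < φ ∧ φ < 2 * Real.pi then
    l₂ * (2 * Real.pi * ((N - 1) / N) - φ)
  else 0

/-- The rate of the phase variable `s` units of time after an adjustment `ψ` has been requested,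
as long as no further pulse occurs: it is `ω₀ ± ωmax`, with the sign of `ψ`, for the duration
`τ = |ψ| / ωmax`, and the fundamental frequency `ω₀` afterwards. -/
noncomputable def controlRate (ω₀ ωmax ψ s : ℝ) : ℝ :=
  if s < |ψ| / ωmax then ω₀ + Real.sign ψ * ωmax else ω₀

/-- An evolution, over all times `t ≥ 0`, of `N` robots with initial headings `θ₀`, connected
all-to-all and using pulse-based heading control under the heading rate bound `ωmax`.
Pulses occur at the times `pulseTime 1 < pulseTime 2 < ⋯`, and `pulseTime 0 = 0` is the start. -/
structure HeadingEvolution (N : ℕ) (ω₀ ωmax l₁ l₂ : ℝ) (θ₀ : Fin N → ℝ) where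
  /-- The times of the successive pulses (from index `1` on). -/
  pulseTime : ℕ → ℝ
  /-- `adjustment n i` is the adjustment `ψ` that robot `i` is carrying out from
  `pulseTime n` on. -/
  adjustment : ℕ → Fin N → ℝ
  /-- `arrival n i` is the value that the phase of robot `i` has reached when the pulse at
  `pulseTime (n + 1)` is emitted, before any reset. -/
  arrival : ℕ → Fin N → ℝ
  /-- The rate of each phase variable, as a function of time. -/
  rate : Fin N → ℝ → ℝ
  /-- The phase variable of each robot, as a function of time. -/
  phase : Fin N → ℝ → ℝ
  /-- The heading of each robot as a function of time; a real number read modulo `2π`. -/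
  heading : Fin N → ℝ → ℝ
  pulseTime_zero : pulseTime 0 = 0
  pulseTime_strictMono : StrictMono pulseTime
  pulseTime_tendsto : Tendsto pulseTime atTop atTop
  /-- The phase variable starts at the initial heading, -/
  phase_zero : ∀ i, phase i 0 = θ₀ i
  /-- and no adjustment is carried out before the first pulse. -/
  adjustment_zero : ∀ i, adjustment 0 i = 0
  /-- Between pulses each robot applies the rate-constrained control to its current
  adjustment, -/
  rate_eq : ∀ n i t, pulseTime n ≤ t → t < pulseTime (n + 1) →
    rate i t = controlRate ω₀ ωmax (adjustment n i) (t - pulseTime n)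
  /-- its phase evolves at that rate, -/
  phase_eq : ∀ n i t, pulseTime n ≤ t → t < pulseTime (n + 1) →
    phase i t = phase i (pulseTime n) + ∫ u in (pulseTime n)..t, rate i u
  /-- and no phase is at the threshold before the next pulse. -/
  phase_lt : ∀ n i t, pulseTime n ≤ t → t < pulseTime (n + 1) → phase i t < 2 * Real.pi
  arrival_eq : ∀ n i,
    arrival n i = phase i (pulseTime n) + ∫ u in (pulseTime n)..(pulseTime (n + 1)), rate i u
  /-- A pulse is emitted when the phase of some robot reaches the threshold `2π`. -/
  exists_fires : ∀ n, ∃ i, arrival n i = 2 * Real.pi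
  /-- A robot that fires resets its phase to zero and drops any unfinished adjustment. -/
  phase_fire : ∀ n i, arrival n i = 2 * Real.pi → phase i (pulseTime (n + 1)) = 0
  adjustment_fire : ∀ n i, arrival n i = 2 * Real.pi → adjustment (n + 1) i = 0
  /-- Every other robot receives the pulse: its phase is continuous, and it replaces its
  adjustment by the one that the phase response function assigns to its current phase. -/
  phase_receive : ∀ n i, arrival n i ≠ 2 * Real.pi → phase i (pulseTime (n + 1)) = arrival n i
  adjustment_receive : ∀ n i, arrival n i ≠ 2 * Real.pi →
    adjustment (n + 1) i = phaseResponse N l₁ l₂ (arrival n i)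
  /-- The heading control `θ̇ = φ̇ - ω₀`, in integrated form. -/
  heading_eq : ∀ i t, 0 ≤ t → heading i t = θ₀ i + ∫ u in (0 : ℝ)..t, (rate i u - ω₀)

namespace HeadingEvolution

variable {N : ℕ} {ω₀ ωmax l₁ l₂ : ℝ} {θ₀ : Fin N → ℝ}

/-- The heading rate constraint `|θ̇| ≤ ωmax`: headings turn continuously and never faster
than `ωmax`. -/
def RespectsRateConstraint (E : HeadingEvolution N ω₀ ωmax l₁ l₂ θ₀) : Prop :=
  ∀ i s t, 0 ≤ s → 0 ≤ t → |E.heading i t - E.heading i s| ≤ ωmax * |t - s|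

/-- The headings converge to desynchronization. The robots are numbered (through `σ`) by
decreasing initial heading, and the difference modulo `2π` of any two cyclically consecutive
headings tends to `2π / N`. -/
def Desynchronizes (E : HeadingEvolution N ω₀ ωmax l₁ l₂ θ₀) : Prop :=
  ∃ σ : Equiv.Perm (Fin N), StrictAnti (fun i => θ₀ (σ i)) ∧
    ∀ i : Fin N, Tendsto
      (fun t : ℝ => toIcoMod Real.two_pi_pos 0
        (E.heading (σ i) t - E.heading (σ (finRotate N i)) t))
      atTop (𝓝 (2 * Real.pi / N))

end HeadingEvolution

end HeadingDesync

/-!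
Robots never overtake each other, because executing an adjustment, even partially, shifts the phases
by a strictly increasing map (`strictMonoOn_add_partialShift`). Hence the robots fire in a fixed
cyclic order. Unrolling the circle turns the states at the pulses into an array `h n m`, the lifted
heading at pulse `n` of the robot that emits pulse `m` (`IsLiftedOrbit`). Let `D = 2π / N`. Measured
against equal spacing, the *offsets* `z n m = h n m + m * D` obey a one-sided averaging law: pulse
`n` moves `z n m` at most by a fraction `l₁ < 1` up, or at most by a fraction `l₂ < 1` down, towards
the offset `z n n` of the firing robot (`IsLiftedOrbit.offset_step`). So the maximum of the offsets
never grows and the minimum never falls. Bounded offsets keep the pulses from accumulating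
(`IsLiftedOrbit.tendsto_time`), which is what existence for all times needs. Desynchronization means
that all offsets have a common limit, and here the two couplings differ.

If `l₁ > 0`, the robot just ahead of a firing robot is pushed forward by a fixed fraction of its lag
in offset before it fires itself (`IsLiftedOrbit.forward_push`), even if its adjustments are
repeatedly cut short. A large offset thus spreads around the ring, and the range of the offsets
contracts geometrically (`IsLiftedOrbit.exists_contraction`).

If `l₁ = 0`, the robot that should lag more is the next one to fire, possibly so soon that it is
hardly pushed back, so no such uniform bound holds in tight clusters. But then each `h n m` is
nonincreasing in `n` and converges, and each limiting gap is either `0` or at least `D`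
(`IsLiftedOrbit.limit_gap`). If some gap exceeded `D`, the robot behind it would be eventually at
rest, and going backwards along gaps equal to `D` the distances of the robots to their limits would
decay about as fast as `(1 - l₂) ^ k` in the `k`-th round. A gap closing in the limit shrinks more
slowly, since it is stretched by the factor `1 + ωmax / ω₀` once a round, while it is bounded by
such a distance; so no further gap is `0` (`IsLiftedOrbit.limit_ne_of_excess_le`). Then all gaps are
at least `D`, one of them exceeds `D`, and their sum exceeds `2π`. Hence every gap equals `D`.
-/

namespace HeadingDesync

/-! ### The phase response and its rate-limited execution -/

/-- The net phase shift produced by an adjustment `ψ` after it has been carried out for `s` units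
of time at the speed `w`: the adjustment `ψ`, truncated to the interval `[-ws, ws]`. -/
noncomputable def partialShift (w s ψ : ℝ) : ℝ := max (-(w * s)) (min (w * s) ψ)

theorem partialShift_of_nonneg {w s ψ : ℝ} (hs : 0 ≤ w * s) (hψ : 0 ≤ ψ) :
    partialShift w s ψ = min (w * s) ψ :=
  max_eq_right (le_min (by linarith) (by linarith))

theorem partialShift_of_nonpos {w s ψ : ℝ} (hs : 0 ≤ w * s) (hψ : ψ ≤ 0) :
    partialShift w s ψ = -min (w * s) (-ψ) := by
  rw [partialShift, min_eq_right (hψ.trans hs), ← max_neg_neg, neg_neg]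

theorem partialShift_zero_right {w s : ℝ} (hs : 0 ≤ w * s) : partialShift w s 0 = 0 := by
  rw [partialShift_of_nonneg hs le_rfl, min_eq_right hs]

theorem partialShift_zero_left (w ψ : ℝ) : partialShift w 0 ψ = 0 := by
  simp [partialShift]

theorem continuous_partialShift (w ψ : ℝ) : Continuous fun s => partialShift w s ψ := by
  unfold partialShift; fun_prop

theorem abs_partialShift_le {w s ψ : ℝ} (hs : 0 ≤ w * s) : |partialShift w s ψ| ≤ |ψ| := by
  rcases le_total 0 ψ with h | h
  · rw [partialShift_of_nonneg hs h, abs_of_nonneg (le_min hs h), abs_of_nonneg h]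
    exact min_le_right _ _
  · rw [partialShift_of_nonpos hs h, abs_neg, abs_of_nonneg (le_min hs (by linarith)),
      abs_of_nonpos h]
    exact min_le_right _ _

theorem partialShift_sub_le {w s ψ ψ' : ℝ} (h : ψ' ≤ ψ) :
    partialShift w s ψ - partialShift w s ψ' ≤ ψ - ψ' := by
  unfold partialShift
  rcases le_total (w * s) ψ with h1 | h1 <;> rcases le_total (w * s) ψ' with h2 | h2 <;>
    simp only [min_eq_left, min_eq_right, h1, h2] <;>
    rcases max_cases (-(w * s)) (w * s) with h3 | h3 <;>
    rcases max_cases (-(w * s)) ψ with h4 | h4 <;>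
    rcases max_cases (-(w * s)) ψ' with h5 | h5 <;> linarith

/-- The shift at an earlier time lies between zero and the shift at a later time. -/
theorem partialShift_mem_uIcc {w s t ψ : ℝ} (hw : 0 ≤ w) (hs : 0 ≤ s) (hst : s ≤ t) :
    partialShift w s ψ ∈ Set.uIcc 0 (partialShift w t ψ) := by
  have h1 : 0 ≤ w * s := mul_nonneg hw hs
  have h2 : w * s ≤ w * t := mul_le_mul_of_nonneg_left hst hw
  rcases le_total 0 ψ with h | h
  · rw [partialShift_of_nonneg h1 h, partialShift_of_nonneg (h1.trans h2) h]
    exact Set.mem_uIcc_of_le (le_min h1 h) (min_le_min_right _ h2)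
  · rw [partialShift_of_nonpos h1 h, partialShift_of_nonpos (h1.trans h2) h]
    exact Set.mem_uIcc_of_ge (neg_le_neg (min_le_min_right _ h2))
      (neg_nonpos.2 (le_min h1 (by linarith)))

section Response

variable {N : ℕ} {l₁ l₂ : ℝ}

theorem two_pi_mul_pred_div (hN : 2 ≤ N) :
    2 * Real.pi * (((N : ℝ) - 1) / N) = 2 * Real.pi - 2 * Real.pi / N := by
  have : (N : ℝ) ≠ 0 := by positivity
  field_simp

theorem natCast_mul_spacing (hN : 2 ≤ N) : (N : ℝ) * (2 * Real.pi / N) = 2 * Real.pi := by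
  have : (N : ℝ) ≠ 0 := by positivity
  field_simp

theorem spacing_pos (hN : 2 ≤ N) : 0 < 2 * Real.pi / N := by
  have : 0 < (N : ℝ) := by positivity
  have := Real.pi_pos
  positivity

theorem spacing_le_pi (hN : 2 ≤ N) : 2 * Real.pi / N ≤ Real.pi := by
  have h2 : (2 : ℝ) ≤ N := by exact_mod_cast hN
  rw [div_le_iff₀ (by linarith)]
  nlinarith [Real.pi_pos]

theorem phaseResponse_of_mem_Ioo (hN : 2 ≤ N) {x : ℝ} (h0 : 0 < x) (h1 : x < 2 * Real.pi) :
    phaseResponse N l₁ l₂ x =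
      l₁ * max (2 * Real.pi / N - x) 0 - l₂ * max (x - (2 * Real.pi - 2 * Real.pi / N)) 0 := by
  have := spacing_le_pi hN
  unfold phaseResponse
  rw [two_pi_mul_pred_div hN]
  split_ifs with h2 h3
  · rw [max_eq_left (by linarith), max_eq_right (by linarith)]; ring
  · rw [max_eq_left (a := x - _) (by linarith), max_eq_right (by linarith)]; ring
  · rw [max_eq_right (a := x - _) (not_lt.1 fun h => h3 ⟨by linarith, h1⟩),
      max_eq_right (not_lt.1 fun h => h2 ⟨h0, by linarith⟩)]
    ring

theorem phaseResponse_zero (hN : 2 ≤ N) : phaseResponse N l₁ l₂ 0 = 0 := by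
  have := spacing_le_pi hN
  have := Real.pi_pos
  unfold phaseResponse
  rw [two_pi_mul_pred_div hN, if_neg (by simp), if_neg (by rintro ⟨h, -⟩; linarith)]

theorem phaseResponse_low (hN : 2 ≤ N) {x : ℝ} (h0 : 0 < x) (h1 : x ≤ 2 * Real.pi / N) :
    phaseResponse N l₁ l₂ x = l₁ * (2 * Real.pi / N - x) := by
  have := spacing_le_pi hN
  have := Real.pi_pos
  rw [phaseResponse_of_mem_Ioo hN h0 (by linarith), max_eq_left (by linarith),
    max_eq_right (by linarith)]
  ring

theorem phaseResponse_high (hN : 2 ≤ N) {x : ℝ} (h0 : 2 * Real.pi / N ≤ x)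
    (h1 : x < 2 * Real.pi) :
    phaseResponse N l₁ l₂ x = -(l₂ * max (x - (2 * Real.pi - 2 * Real.pi / N)) 0) := by
  have := spacing_pos hN
  rw [phaseResponse_of_mem_Ioo hN (by linarith) h1, max_eq_right (by linarith)]
  ring

theorem phaseResponse_zero_zero (x : ℝ) : phaseResponse N 0 0 x = 0 := by
  simp [phaseResponse]

/-- One carried-out adjustment never makes a robot overtake another one: the shifted phase is a
strictly increasing function of the phase. -/
theorem strictMonoOn_add_partialShift (hN : 2 ≤ N) (hl₁ : l₁ ∈ Set.Ico (0 : ℝ) 1)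
    (hl₂ : l₂ ∈ Set.Ico (0 : ℝ) 1) {w s : ℝ} (hs : 0 ≤ w * s) :
    StrictMonoOn (fun x => x + partialShift w s (phaseResponse N l₁ l₂ x))
      (Set.Ico 0 (2 * Real.pi)) := by
  obtain ⟨a1, a2⟩ := hl₁
  obtain ⟨b1, b2⟩ := hl₂
  have hD := spacing_le_pi hN
  have hD0 := spacing_pos hN
  have hpi := Real.pi_pos
  rintro x ⟨hx0, hx1⟩ y ⟨hy0, hy1⟩ hxy
  simp only
  rcases hx0.eq_or_lt with rfl | hx0
  · rw [phaseResponse_zero hN, partialShift_zero_right hs, add_zero]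
    rcases le_total y (2 * Real.pi / N) with h | h
    · rw [phaseResponse_low hN hxy h, partialShift_of_nonneg hs (by nlinarith)]
      have := le_min hs (show 0 ≤ l₁ * (2 * Real.pi / N - y) by nlinarith)
      linarith
    · rw [phaseResponse_high hN h hy1]
      have h1 := abs_partialShift_le (ψ := -(l₂ * max (y - (2 * Real.pi - 2 * Real.pi / N)) 0)) hs
      rw [abs_neg, abs_of_nonneg (mul_nonneg b1 (le_max_right _ _))] at h1
      have h2 := neg_le_of_abs_le h1
      rcases max_cases (y - (2 * Real.pi - 2 * Real.pi / N)) 0 with h3 | h3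
      · rw [h3.1] at h2 ⊢; nlinarith
      · rw [h3.1] at h2 ⊢; nlinarith
  · have hy0 : 0 < y := hx0.trans hxy
    rw [phaseResponse_of_mem_Ioo hN hx0 hx1, phaseResponse_of_mem_Ioo hN hy0 hy1]
    set D := 2 * Real.pi / N
    have e1 : max (D - y) 0 ≤ max (D - x) 0 := max_le_max (by linarith) le_rfl
    have e2 : max (x - (2 * Real.pi - D)) 0 ≤ max (y - (2 * Real.pi - D)) 0 :=
      max_le_max (by linarith) le_rfl
    have h1 := partialShift_sub_le (w := w) (s := s)
      (ψ := l₁ * max (D - x) 0 - l₂ * max (x - (2 * Real.pi - D)) 0)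
      (ψ' := l₁ * max (D - y) 0 - l₂ * max (y - (2 * Real.pi - D)) 0) (by nlinarith)
    have e3 : (max (D - x) 0 - max (D - y) 0) +
        (max (y - (2 * Real.pi - D)) 0 - max (x - (2 * Real.pi - D)) 0) ≤ y - x := by
      rcases max_cases (D - x) 0 with c1 | c1 <;> rcases max_cases (D - y) 0 with c2 | c2 <;>
      rcases max_cases (y - (2 * Real.pi - D)) 0 with c3 | c3 <;>
      rcases max_cases (x - (2 * Real.pi - D)) 0 with c4 | c4 <;>
      rw [c1.1, c2.1, c3.1, c4.1] <;> linarith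
    have e4 : l₁ * (max (D - x) 0 - max (D - y) 0) +
        l₂ * (max (y - (2 * Real.pi - D)) 0 - max (x - (2 * Real.pi - D)) 0) ≤
        max l₁ l₂ * (y - x) := by
      have m1 := le_max_left l₁ l₂
      have m2 := le_max_right l₁ l₂
      calc _ ≤ max l₁ l₂ * (max (D - x) 0 - max (D - y) 0) + max l₁ l₂ *
            (max (y - (2 * Real.pi - D)) 0 - max (x - (2 * Real.pi - D)) 0) :=
          add_le_add (mul_le_mul_of_nonneg_right m1 (by linarith))
            (mul_le_mul_of_nonneg_right m2 (by linarith))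
        _ ≤ _ := by rw [← mul_add]; exact mul_le_mul_of_nonneg_left e3 (a1.trans m1)
    have e5 : max l₁ l₂ * (y - x) < y - x := by
      have : max l₁ l₂ < 1 := max_lt a2 b2
      nlinarith
    linarith

theorem add_partialShift_mem_Ico (hN : 2 ≤ N) (hl₁ : l₁ ∈ Set.Ico (0 : ℝ) 1)
    (hl₂ : l₂ ∈ Set.Ico (0 : ℝ) 1) {w s : ℝ} (hs : 0 ≤ w * s) {x : ℝ}
    (hx : x ∈ Set.Ico 0 (2 * Real.pi)) :
    x + partialShift w s (phaseResponse N l₁ l₂ x) ∈ Set.Ico 0 (2 * Real.pi) := by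
  have hpi := Real.pi_pos
  have h0 : (0 : ℝ) ∈ Set.Ico 0 (2 * Real.pi) := ⟨le_rfl, by linarith⟩
  refine ⟨?_, ?_⟩
  · have := (strictMonoOn_add_partialShift hN hl₁ hl₂ hs).monotoneOn h0 hx hx.1
    simpa [phaseResponse_zero hN, partialShift_zero_right hs] using this
  · have hD := spacing_le_pi hN
    rcases hx.1.eq_or_lt with h | h
    · simp [← h, phaseResponse_zero hN, partialShift_zero_right hs, hpi]
    rcases le_total x (2 * Real.pi / N) with h' | h'
    · rw [phaseResponse_low hN h h', partialShift_of_nonneg hs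
        (mul_nonneg hl₁.1 (by linarith))]
      have := min_le_right (w * s) (l₁ * (2 * Real.pi / N - x))
      nlinarith [hl₁.1, hl₁.2]
    · have h1 : phaseResponse N l₁ l₂ x ≤ 0 := by
        rw [phaseResponse_high hN h' hx.2, neg_nonpos]
        exact mul_nonneg hl₂.1 (le_max_right _ _)
      rw [partialShift_of_nonpos hs h1]
      have := le_min hs (neg_nonneg.2 h1)
      linarith [hx.2]

end Response

/-! ### Lifted orbits -/

/-- The discrete skeleton of an evolution, with the circle of robots unrolled. Label `m` stands for
the robot that emits the `m`-th pulse, so that labels which agree modulo `N` name the same robot;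
`h n m` is the heading of label `m` at the `n`-th pulse, lifted to `ℝ` so that it drops by `2π` when
`m` grows by `N`, and `T n` is the time of the `n`-th pulse. The phase of the label `n + r` with
`1 ≤ r ≤ N` right after that pulse is `h n (n + r) + ω₀ * T n`; for `r = N` this is the robot that
has just fired, at phase `0`. -/
structure IsLiftedOrbit (N : ℕ) (ω₀ w l₁ l₂ : ℝ) (h : ℕ → ℕ → ℝ) (T : ℕ → ℝ) : Prop where
  periodic : ∀ n m, h n (m + N) = h n m - 2 * Real.pi
  strictAnti : ∀ n, StrictAnti (h n)
  time_lt : ∀ n, T n < T (n + 1)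
  fire : ∀ n, h n n + ω₀ * T n = 2 * Real.pi
  step : ∀ n r, 1 ≤ r → r ≤ N → h (n + 1) (n + r) = h n (n + r) +
    partialShift w (T (n + 1) - T n) (phaseResponse N l₁ l₂ (h n (n + r) + ω₀ * T n))

/-- The deviation of the lifted heading of label `m` from the equally spaced pattern `-m * 2π / N`.
Desynchronization means that all offsets agree in the limit. -/
noncomputable def offset (N : ℕ) (h : ℕ → ℕ → ℝ) (n m : ℕ) : ℝ := h n m + m * (2 * Real.pi / N)

theorem exists_label_mod_eq {N : ℕ} (hN : 2 ≤ N) (n m : ℕ) :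
    ∃ r, 1 ≤ r ∧ r ≤ N ∧ (n + r) % N = m % N := by
  refine ⟨(m + (N - 1) * (n + 1)) % N + 1, by omega, ?_, ?_⟩
  · have := Nat.mod_lt (m + (N - 1) * (n + 1)) (show 0 < N by omega)
    omega
  · have h1 : n + ((m + (N - 1) * (n + 1)) % N + 1) ≡ n + (m + (N - 1) * (n + 1) + 1) [MOD N] :=
      ((Nat.mod_modEq _ _).add_right 1).add_left n
    have h2 : n + (m + (N - 1) * (n + 1) + 1) = m + N * (n + 1) := by
      obtain ⟨k, rfl⟩ : ∃ k, N = k + 1 := ⟨N - 1, by omega⟩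
      simp only [Nat.add_sub_cancel]; ring
    rw [h2] at h1
    simpa [Nat.ModEq] using h1

theorem exists_lt_label_mod_eq {N : ℕ} (hN : 2 ≤ N) (n m : ℕ) :
    ∃ r < N, (n + r) % N = m % N := by
  obtain ⟨r, h1, h2, h3⟩ := exists_label_mod_eq hN n m
  rcases h2.eq_or_lt with rfl | h2
  · exact ⟨0, by omega, by simpa using h3⟩
  · exact ⟨r, h2, h3⟩

/-- A real sequence that drops by a constant over each period is strictly decreasing as soon as it
is so over one period. -/
theorem strictAnti_of_window {N : ℕ} (hN : 2 ≤ N) {f : ℕ → ℝ} {c : ℝ}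
    (hf : ∀ m, f (m + N) = f m - c) (n : ℕ)
    (h : ∀ r < N, f (n + r + 1) < f (n + r)) : StrictAnti f := by
  refine strictAnti_nat_of_succ_lt fun m => ?_
  obtain ⟨r, h2, h3⟩ := exists_lt_label_mod_eq hN n m
  have hper : Function.Periodic (fun m => f m - f (m + 1)) N := fun m => by
    simp only
    rw [hf, show m + N + 1 = m + 1 + N by ring, hf]; ring
  have e1 := hper.map_mod_nat m
  have e2 := hper.map_mod_nat (n + r)
  rw [h3] at e2
  have := h r h2
  linarith

namespace IsLiftedOrbit

variable {N : ℕ} {ω₀ w l₁ l₂ : ℝ} {h : ℕ → ℕ → ℝ} {T : ℕ → ℝ}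

theorem offset_periodic (O : IsLiftedOrbit N ω₀ w l₁ l₂ h T) (hN : 2 ≤ N) (n : ℕ) :
    Function.Periodic (offset N h n) N := fun m => by
  have := natCast_mul_spacing hN
  simp only [offset, O.periodic]; push_cast; linarith

theorem offset_congr (O : IsLiftedOrbit N ω₀ w l₁ l₂ h T) (hN : 2 ≤ N) (n : ℕ) {m m' : ℕ}
    (hm : m % N = m' % N) : offset N h n m = offset N h n m' := by
  rw [← (O.offset_periodic hN n).map_mod_nat m, hm, (O.offset_periodic hN n).map_mod_nat m']

theorem phase_pos (O : IsLiftedOrbit N ω₀ w l₁ l₂ h T) {n r : ℕ} (hr : r < N) :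
    0 < h n (n + r) + ω₀ * T n := by
  have h1 := O.strictAnti n (show n + r < n + N by omega)
  have h2 := O.periodic n n
  have h3 := O.fire n
  linarith

theorem phase_lt (O : IsLiftedOrbit N ω₀ w l₁ l₂ h T) {n r : ℕ} (hr : 1 ≤ r) :
    h n (n + r) + ω₀ * T n < 2 * Real.pi := by
  have h1 := O.strictAnti n (show n < n + r by omega)
  have h3 := O.fire n
  linarith

theorem phase_base (O : IsLiftedOrbit N ω₀ w l₁ l₂ h T) (n : ℕ) :
    h n (n + N) + ω₀ * T n = 0 := by
  have h2 := O.periodic n n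
  have h3 := O.fire n
  linarith

theorem step_base (O : IsLiftedOrbit N ω₀ w l₁ l₂ h T) (hN : 2 ≤ N) (hw : 0 < w) (n : ℕ) :
    h (n + 1) (n + N) = h n (n + N) := by
  rw [O.step n N (by omega) le_rfl, O.phase_base, phaseResponse_zero hN,
    partialShift_zero_right (by have := O.time_lt n; nlinarith), add_zero]

/-- A pulse moves the offset of each label towards the offset of the firing label `n`, by a
fraction of their difference that is at most `l₁` on the way up and at most `l₂` on the way down;
or it leaves the offset unchanged. -/
theorem offset_step (O : IsLiftedOrbit N ω₀ w l₁ l₂ h T) (hN : 2 ≤ N) (hw : 0 < w)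
    (hl₁ : 0 ≤ l₁) (hl₂ : 0 ≤ l₂) (n m : ℕ) :
    (offset N h n m ≤ offset N h (n + 1) m ∧
      offset N h (n + 1) m ≤ offset N h n m + l₁ * (offset N h n n - offset N h n m)) ∨
    (offset N h (n + 1) m ≤ offset N h n m ∧
      offset N h n m - l₂ * (offset N h n m - offset N h n n) ≤ offset N h (n + 1) m) := by
  obtain ⟨r, hr1, hrN, hr⟩ := exists_label_mod_eq hN n m
  rw [← O.offset_congr hN n hr, ← O.offset_congr hN (n + 1) hr]
  have hs : 0 ≤ w * (T (n + 1) - T n) := by have := O.time_lt n; nlinarith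
  have hD := spacing_pos hN
  have hDpi := spacing_le_pi hN
  have hND := natCast_mul_spacing hN
  have same : h (n + 1) (n + r) = h n (n + r) →
    (offset N h n (n + r) ≤ offset N h (n + 1) (n + r) ∧
      offset N h (n + 1) (n + r) ≤
        offset N h n (n + r) + l₁ * (offset N h n n - offset N h n (n + r))) ∨
    (offset N h (n + 1) (n + r) ≤ offset N h n (n + r) ∧
      offset N h n (n + r) - l₂ * (offset N h n (n + r) - offset N h n n) ≤
        offset N h (n + 1) (n + r)) := by
    intro e
    have e' : offset N h (n + 1) (n + r) = offset N h n (n + r) := by simp only [offset, e]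
    rw [e']
    rcases le_total (offset N h n n) (offset N h n (n + r)) with hle | hle
    · exact Or.inr ⟨le_rfl, by nlinarith⟩
    · exact Or.inl ⟨le_rfl, by nlinarith⟩
  rcases hrN.eq_or_lt with rfl | hrN'
  · exact same (O.step_base hN hw n)
  have hx0 := O.phase_pos (n := n) hrN'
  have hx1 := O.phase_lt (n := n) hr1
  have hf := O.fire n
  have hst := O.step n r hr1 hrN
  have hr1' : (1 : ℝ) ≤ r := by exact_mod_cast hr1
  have hrN'' : (r : ℝ) + 1 ≤ N := by exact_mod_cast hrN'
  rcases le_total (h n (n + r) + ω₀ * T n) (2 * Real.pi / N) with hlo | hlo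
  · left
    rw [phaseResponse_low hN hx0 hlo, partialShift_of_nonneg hs
      (mul_nonneg hl₁ (by linarith))] at hst
    have e1 := min_le_right (w * (T (n + 1) - T n))
      (l₁ * (2 * Real.pi / N - (h n (n + r) + ω₀ * T n)))
    have e2 := le_min hs (mul_nonneg hl₁ (sub_nonneg.2 hlo))
    refine ⟨by simp only [offset, hst]; linarith, ?_⟩
    have e3 : 2 * Real.pi / N - (h n (n + r) + ω₀ * T n) ≤
        offset N h n n - offset N h n (n + r) := by
      simp only [offset]; push_cast
      nlinarith
    have e4 := mul_le_mul_of_nonneg_left e3 hl₁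
    have e5 : offset N h (n + 1) (n + r) - offset N h n (n + r) =
      h (n + 1) (n + r) - h n (n + r) := by simp only [offset]; ring
    linarith
  · rcases le_total (h n (n + r) + ω₀ * T n) (2 * Real.pi - 2 * Real.pi / N) with hmid | hhi
    · refine same ?_
      rw [hst, phaseResponse_high hN hlo hx1, max_eq_right (by linarith), mul_zero, neg_zero,
        partialShift_zero_right hs, add_zero]
    · right
      rw [phaseResponse_high hN hlo hx1, max_eq_left (by linarith), partialShift_of_nonpos hs
        (neg_nonpos.2 (mul_nonneg hl₂ (by linarith))), neg_neg] at hst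
      have e1 := min_le_right (w * (T (n + 1) - T n))
        (l₂ * (h n (n + r) + ω₀ * T n - (2 * Real.pi - 2 * Real.pi / N)))
      have e2 := le_min hs (mul_nonneg hl₂ (sub_nonneg.2 hhi))
      refine ⟨by simp only [offset, hst]; linarith, ?_⟩
      have e3 : h n (n + r) + ω₀ * T n - (2 * Real.pi - 2 * Real.pi / N) ≤
          offset N h n (n + r) - offset N h n n := by
        simp only [offset]; push_cast
        nlinarith
      have e4 := mul_le_mul_of_nonneg_left e3 hl₂
      have e5 : offset N h (n + 1) (n + r) - offset N h n (n + r) =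
        h (n + 1) (n + r) - h n (n + r) := by simp only [offset]; ring
      linarith

theorem offset_le (O : IsLiftedOrbit N ω₀ w l₁ l₂ h T) (hN : 2 ≤ N) (hw : 0 < w)
    (hl₁ : l₁ ∈ Set.Ico (0 : ℝ) 1) (hl₂ : 0 ≤ l₂) {n n' : ℕ} (hn : n ≤ n') {b : ℝ}
    (hb : ∀ m, offset N h n m ≤ b) : ∀ m, offset N h n' m ≤ b := by
  induction n', hn using Nat.le_induction with
  | base => exact hb
  | succ k _ ih =>
    intro m
    rcases O.offset_step hN hw hl₁.1 hl₂ k m with ⟨-, h1⟩ | ⟨h1, -⟩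
    · nlinarith [ih m, ih k, hl₁.1, hl₁.2]
    · exact h1.trans (ih m)

theorem offset_ge (O : IsLiftedOrbit N ω₀ w l₁ l₂ h T) (hN : 2 ≤ N) (hw : 0 < w)
    (hl₁ : 0 ≤ l₁) (hl₂ : l₂ ∈ Set.Ico (0 : ℝ) 1) {n n' : ℕ} (hn : n ≤ n') {a : ℝ}
    (ha : ∀ m, a ≤ offset N h n m) :
    ∀ m, a + (1 - l₂) ^ (n' - n) * (offset N h n m - a) ≤ offset N h n' m := by
  obtain ⟨h0, h1⟩ := hl₂
  induction n', hn using Nat.le_induction with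
  | base => simp
  | succ k hk ih =>
    intro m
    have hp : 0 ≤ (1 - l₂) ^ (k - n) := pow_nonneg (by linarith) _
    have hge : ∀ m, a ≤ offset N h k m := fun m => by
      nlinarith [ih m, mul_nonneg hp (sub_nonneg.2 (ha m))]
    rw [Nat.sub_add_comm hk, pow_succ]
    have e : (1 - l₂) * ((1 - l₂) ^ (k - n) * (offset N h n m - a)) ≤
      (1 - l₂) * (offset N h k m - a) :=
      mul_le_mul_of_nonneg_left (by linarith [ih m]) (by linarith)
    rcases O.offset_step hN hw hl₁ h0 k m with ⟨h2, -⟩ | ⟨-, h2⟩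
    · nlinarith [hge m]
    · nlinarith [hge k]

theorem offset_ge' (O : IsLiftedOrbit N ω₀ w l₁ l₂ h T) (hN : 2 ≤ N) (hw : 0 < w)
    (hl₁ : 0 ≤ l₁) (hl₂ : l₂ ∈ Set.Ico (0 : ℝ) 1) {n n' : ℕ} (hn : n ≤ n') {a : ℝ}
    (ha : ∀ m, a ≤ offset N h n m) (m : ℕ) : a ≤ offset N h n' m := by
  have h1 := O.offset_ge hN hw hl₁ hl₂ hn ha m
  have h2 := mul_nonneg (pow_nonneg (sub_nonneg.2 hl₂.2.le) (n' - n)) (sub_nonneg.2 (ha m))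
  linarith

theorem exists_offset_bounds (O : IsLiftedOrbit N ω₀ w l₁ l₂ h T) (hN : 2 ≤ N) (n : ℕ) :
    ∃ a b, ∀ m, a ≤ offset N h n m ∧ offset N h n m ≤ b := by
  have hne : (Finset.range N).Nonempty := ⟨0, by simp; omega⟩
  refine ⟨(Finset.range N).inf' hne (offset N h n), (Finset.range N).sup' hne (offset N h n),
    fun m => ?_⟩
  have hm : m % N ∈ Finset.range N := Finset.mem_range.2 (Nat.mod_lt _ (by omega))
  rw [← (O.offset_periodic hN n).map_mod_nat m]
  exact ⟨Finset.inf'_le _ hm, Finset.le_sup' _ hm⟩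

/-- The pulses do not accumulate: the offsets are bounded above, so label `n` fires late. -/
theorem tendsto_time (O : IsLiftedOrbit N ω₀ w l₁ l₂ h T) (hN : 2 ≤ N) (hω₀ : 0 < ω₀)
    (hw : 0 < w) (hl₁ : l₁ ∈ Set.Ico (0 : ℝ) 1) (hl₂ : 0 ≤ l₂) : Tendsto T atTop atTop := by
  obtain ⟨a, b, hab⟩ := O.exists_offset_bounds hN 0
  have hb := fun n => O.offset_le hN hw hl₁ hl₂ (Nat.zero_le n) (fun m => (hab m).2)
  have hD := spacing_pos hN
  have h1 : Tendsto (fun n : ℕ => (2 * Real.pi - b) / ω₀ + n * (2 * Real.pi / N / ω₀)) atTop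
      atTop :=
    tendsto_atTop_add_const_left _ _
      (tendsto_natCast_atTop_atTop.atTop_mul_const (by positivity))
  refine tendsto_atTop_mono (fun n => ?_) h1
  have h2 := hb n n
  have h3 := O.fire n
  simp only [offset] at h2
  have : ω₀ * ((2 * Real.pi - b) / ω₀ + n * (2 * Real.pi / N / ω₀)) ≤ ω₀ * T n := by
    have e : ω₀ * ((2 * Real.pi - b) / ω₀ + n * (2 * Real.pi / N / ω₀)) =
      2 * Real.pi - b + n * (2 * Real.pi / N) := by field_simp
    linarith
  exact le_of_mul_le_mul_left this hω₀

/-! ### Convergence with forward coupling -/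

/-- Between the pulse `n` and its own next pulse, the robot just ahead of the firing one makes up a
fixed fraction `c` of its lag. Single adjustments may be cut short by further pulses, but as long as
half of the lag remains each of those pulses requests at least the adjustment `l₁ / 2` times the
lag: either one such adjustment is completed, or the robot runs at full speed all the time. -/
theorem forward_push (O : IsLiftedOrbit N ω₀ w l₁ l₂ h T) (hN : 2 ≤ N) (hω₀ : 0 < ω₀)
    (hw : 0 < w) (hl₁ : 0 < l₁) {c : ℝ} (hc1 : c ≤ l₁ / 2) (hc2 : c * (w + ω₀) ≤ w / 2)
    (n : ℕ) (hη : offset N h n (n + (N - 1)) < offset N h n n) :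
    ∃ k ≤ N - 1, offset N h n (n + (N - 1)) +
        c * (offset N h n n - offset N h n (n + (N - 1))) ≤ offset N h (n + k) (n + (N - 1)) := by
  set p := n + (N - 1) with hp
  set η := offset N h n n - offset N h n p with hηd
  have hη0 : 0 < η := sub_pos.2 hη
  have hD := spacing_pos hN
  have hDpi := spacing_le_pi hN
  have hpi := Real.pi_pos
  have hND := natCast_mul_spacing hN
  have hNc : ((N - 1 : ℕ) : ℝ) = N - 1 := by rw [Nat.cast_sub (by omega)]; simp
  have hφ : h n p + ω₀ * T n = 2 * Real.pi / N - η := by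
    have hf := O.fire n
    simp only [hηd, offset, hp]; push_cast [hNc]
    nlinarith
  by_contra! hcon
  have hP : ∀ k ≤ N - 1, h (n + k) p - h n p < c * η := fun k hk => by
    have := hcon k hk
    simp only [offset] at this ⊢
    simp only [offset] at hηd
    linarith
  have key : ∀ k ≤ N - 1, w * (T (n + k) - T n) ≤ h (n + k) p - h n p →
      h (n + k) p + ω₀ * T (n + k) < 2 * Real.pi / N - η / 2 := by
    intro k hk hk'
    have h1 := hP k hk
    have h2 : ω₀ * (T (n + k) - T n) + (h (n + k) p - h n p) < η / 2 := by
      have e1 : w * (ω₀ * (T (n + k) - T n) + (h (n + k) p - h n p)) ≤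
          (w + ω₀) * (h (n + k) p - h n p) := by nlinarith
      have e2 : (w + ω₀) * (h (n + k) p - h n p) < (w + ω₀) * (c * η) :=
        mul_lt_mul_of_pos_left h1 (by linarith)
      have e3 : (w + ω₀) * (c * η) ≤ w * (η / 2) := by nlinarith
      exact lt_of_mul_lt_mul_left (e1.trans_lt (e2.trans_le e3)) hw.le
    linarith
  have ind : ∀ k ≤ N - 1, w * (T (n + k) - T n) ≤ h (n + k) p - h n p := by
    have hmin : ∀ k ≤ N - 1,
        min (l₁ * (η / 2)) (w * (T (n + k) - T n)) ≤ h (n + k) p - h n p := by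
      intro k
      induction k with
      | zero => intro _; simp
      | succ k ih =>
        intro hk
        have ih := ih (by omega)
        have h1 : w * (T (n + k) - T n) ≤ h (n + k) p - h n p := by
          rcases min_le_iff.1 ih with h1 | h1
          · have := hP k (by omega)
            nlinarith
          · exact h1
        have hphi := key k (by omega) h1
        have hpr : p = n + k + (N - 1 - k) := by omega
        have hpos : 0 < h (n + k) p + ω₀ * T (n + k) := by
          rw [hpr]; exact O.phase_pos (by omega)
        have hst := O.step (n + k) (N - 1 - k) (by omega) (by omega)
        have ht : 0 ≤ w * (T (n + k + 1) - T (n + k)) := by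
          have := O.time_lt (n + k); nlinarith
        rw [← hpr, phaseResponse_low hN hpos (by linarith), partialShift_of_nonneg ht
          (mul_nonneg hl₁.le (by linarith))] at hst
        rw [← add_assoc, hst]
        rcases min_cases (w * (T (n + k + 1) - T (n + k)))
          (l₁ * (2 * Real.pi / N - (h (n + k) p + ω₀ * T (n + k)))) with ⟨e, -⟩ | ⟨e, -⟩
        · rw [e]; exact (min_le_right _ _).trans (by linarith)
        · rw [e]
          refine (min_le_left _ _).trans ?_
          have : 0 ≤ w * (T (n + k) - T n) := mul_nonneg hw.le
            (sub_nonneg.2 ((strictMono_nat_of_lt_succ O.time_lt).monotone (by omega)))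
          nlinarith
    intro k hk
    rcases min_le_iff.1 (hmin k hk) with h1 | h1
    · have := hP k hk
      nlinarith
    · exact h1
  have hlast := key (N - 1) le_rfl (ind (N - 1) le_rfl)
  have := O.fire (n + (N - 1))
  rw [← hp] at this hlast
  linarith

/-- Lower bounds on the excess of the offset over `a` are passed on from each firing robot to the
robot ahead of it, at the latter's own pulse. -/
theorem forward_chain (O : IsLiftedOrbit N ω₀ w l₁ l₂ h T) (hN : 2 ≤ N) (hω₀ : 0 < ω₀)
    (hw : 0 < w) (hl₁ : 0 < l₁) (hl₂ : l₂ ∈ Set.Ico (0 : ℝ) 1) {c : ℝ} (hc0 : 0 ≤ c) (hc : c ≤ 1)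
    (hc1 : c ≤ l₁ / 2) (hc2 : c * (w + ω₀) ≤ w / 2) (n : ℕ) {a : ℝ}
    (ha : ∀ m, a ≤ offset N h n m) :
    c * (1 - l₂) ^ N * (offset N h n n - a) ≤
      offset N h (n + (N - 1)) (n + (N - 1)) - a := by
  have hq0 : 0 ≤ 1 - l₂ := by linarith [hl₂.2]
  have hq1 : 1 - l₂ ≤ 1 := by linarith [hl₂.1]
  -- A robot that already is at least as far ahead in offset needs no push.
  have main : ∃ k ≤ N - 1, c * (offset N h n n - a) ≤ offset N h (n + k) (n + (N - 1)) - a := by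
    rcases lt_or_ge (offset N h n (n + (N - 1))) (offset N h n n) with hη | hη
    · obtain ⟨k, hk, hk'⟩ := O.forward_push hN hω₀ hw hl₁ hc1 hc2 n hη
      refine ⟨k, hk, ?_⟩
      nlinarith [ha (n + (N - 1))]
    · refine ⟨0, by omega, ?_⟩
      rw [add_zero]
      nlinarith [ha n]
  obtain ⟨k, hk, hk'⟩ := main
  have h1 := O.offset_ge hN hw hl₁.le hl₂ (show n + k ≤ n + (N - 1) by omega)
    (fun m => O.offset_ge' hN hw hl₁.le hl₂ (Nat.le_add_right n k) ha m) (n + (N - 1))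
  have h2 : (1 - l₂) ^ N ≤ (1 - l₂) ^ (n + (N - 1) - (n + k)) :=
    pow_le_pow_of_le_one hq0 hq1 (by omega)
  have h3 : 0 ≤ c * (offset N h n n - a) := mul_nonneg hc0 (sub_nonneg.2 (ha n))
  have h4 := mul_le_mul h2 hk' h3 (pow_nonneg hq0 _)
  nlinarith

/-- Over `N²` pulses the range of the offsets shrinks by a fixed factor: unless the upper half of
`[a, b]` holds no offset, a label with an offset in it fires within `N` pulses, and from there
`forward_chain` reaches every robot in at most `N` links. -/
theorem exists_contraction (O : IsLiftedOrbit N ω₀ w l₁ l₂ h T) (hN : 2 ≤ N) (hω₀ : 0 < ω₀)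
    (hw : 0 < w) (hl₁ : 0 < l₁) (hl₁' : l₁ < 1) (hl₂ : l₂ ∈ Set.Ico (0 : ℝ) 1) :
    ∃ κ, 0 ≤ κ ∧ κ < 1 ∧ ∀ n a b, (∀ m, a ≤ offset N h n m ∧ offset N h n m ≤ b) →
      ∃ a' b', b' - a' ≤ κ * (b - a) ∧
        ∀ m, a' ≤ offset N h (n + N * N) m ∧ offset N h (n + N * N) m ≤ b' := by
  have hq0 : 0 < 1 - l₂ := by linarith [hl₂.2]
  have hq1 : 1 - l₂ ≤ 1 := by linarith [hl₂.1]
  set c := min (l₁ / 2) (w / (2 * (w + ω₀))) with hcd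
  have hc0 : 0 < c := lt_min (by linarith) (by positivity)
  have hc1 : c ≤ l₁ / 2 := min_le_left _ _
  have hc : c ≤ 1 := by linarith
  have hc2 : c * (w + ω₀) ≤ w / 2 := by
    calc c * (w + ω₀) ≤ w / (2 * (w + ω₀)) * (w + ω₀) :=
          mul_le_mul_of_nonneg_right (min_le_right _ _) (by linarith)
      _ = w / 2 := by field_simp
  set d := c * (1 - l₂) ^ N with hd
  have hd0 : 0 < d := by positivity
  have hd1 : d ≤ 1 := mul_le_one₀ hc (by positivity) (pow_le_one₀ hq0.le hq1)
  have chain : ∀ n a, (∀ m, a ≤ offset N h n m) → ∀ j : ℕ,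
      d ^ j * (offset N h n n - a) ≤
        offset N h (n + j * (N - 1)) (n + j * (N - 1)) - a := by
    intro n a ha j
    induction j with
    | zero => simp
    | succ j ih =>
      have h1 := O.forward_chain hN hω₀ hw hl₁ hl₂ hc0.le hc hc1 hc2 (n + j * (N - 1))
        (fun m => O.offset_ge' hN hw hl₁.le hl₂ (Nat.le_add_right n _) ha m)
      rw [show n + (j + 1) * (N - 1) = n + j * (N - 1) + (N - 1) by ring, pow_succ]
      have h2 := mul_le_mul_of_nonneg_left ih hd0.le
      linarith
  set C := (1 - l₂) ^ (N * N) * (d ^ N * ((1 - l₂) ^ N * (1 / 2))) with hC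
  have hC0 : 0 < C := by positivity
  have hC1 : C ≤ 1 / 2 := by
    have h1 : (1 - l₂) ^ (N * N) ≤ 1 := pow_le_one₀ hq0.le hq1
    have h2 : d ^ N ≤ 1 := pow_le_one₀ hd0.le hd1
    have h3 : (1 - l₂) ^ N * (1 / 2) ≤ 1 / 2 :=
      mul_le_of_le_one_left (by norm_num) (pow_le_one₀ hq0.le hq1)
    have h4 : d ^ N * ((1 - l₂) ^ N * (1 / 2)) ≤ 1 / 2 :=
      (mul_le_of_le_one_left (by positivity) h2).trans h3
    exact (mul_le_of_le_one_left (by positivity) h1).trans h4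
  refine ⟨1 - C, by linarith, by linarith, fun n a b hab => ?_⟩
  have hab0 : a ≤ b := (hab 0).1.trans (hab 0).2
  have ha : ∀ m, a ≤ offset N h n m := fun m => (hab m).1
  by_cases hmid : ∀ m, offset N h n m ≤ (a + b) / 2
  · exact ⟨a, (a + b) / 2, by nlinarith, fun m =>
      ⟨O.offset_ge' hN hw hl₁.le hl₂ (Nat.le_add_right n _) ha m,
        O.offset_le hN hw ⟨hl₁.le, hl₁'⟩ hl₂.1 (Nat.le_add_right n _) hmid m⟩⟩
  · push Not at hmid
    obtain ⟨m, hm⟩ := hmid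
    obtain ⟨r, hr1, hrN, hr⟩ := exists_label_mod_eq hN n m
    refine ⟨a + C * (b - a), b, by linarith, fun m' => ⟨?_, O.offset_le hN hw ⟨hl₁.le, hl₁'⟩ hl₂.1
      (Nat.le_add_right n _) (fun m => (hab m).2) m'⟩⟩
    rw [← O.offset_congr hN n hr] at hm
    have s1 : (1 - l₂) ^ N * (1 / 2) * (b - a) ≤ offset N h (n + r) (n + r) - a := by
      have h1 := O.offset_ge hN hw hl₁.le hl₂ (Nat.le_add_right n r) ha (n + r)
      have h2 : (1 - l₂) ^ N ≤ (1 - l₂) ^ (n + r - n) :=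
        pow_le_pow_of_le_one hq0.le hq1 (by omega)
      have h3 : 1 / 2 * (b - a) ≤ offset N h n (n + r) - a := by linarith
      have h4 := mul_le_mul h2 h3 (by linarith) (pow_nonneg hq0.le _)
      linarith
    obtain ⟨j, hj1, hjN, hj⟩ := exists_label_mod_eq hN m' (n + r)
    have hlab : (n + r + j * (N - 1)) % N = m' % N := by
      have e1 : n + r + j * (N - 1) + j = n + r + j * N := by
        obtain ⟨k, rfl⟩ : ∃ k, N = k + 1 := ⟨N - 1, by omega⟩
        simp only [Nat.add_sub_cancel]; ring
      have e2 : n + r + j * (N - 1) + j ≡ m' + j [MOD N] := by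
        rw [e1, Nat.ModEq, Nat.add_mul_mod_self_right, hj]
      exact Nat.ModEq.add_right_cancel' j e2
    have hev : n + r + j * (N - 1) ≤ n + N * N := by
      have : j * (N - 1) ≤ N * (N - 1) := Nat.mul_le_mul_right _ hjN
      have : N * (N - 1) + N = N * N := by
        obtain ⟨k, rfl⟩ : ∃ k, N = k + 1 := ⟨N - 1, by omega⟩
        simp only [Nat.add_sub_cancel]; ring
      omega
    have s2 := chain (n + r) a
      (fun m => O.offset_ge' hN hw hl₁.le hl₂ (Nat.le_add_right n r) ha m) j
    have s3 : d ^ N * ((1 - l₂) ^ N * (1 / 2) * (b - a)) ≤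
        d ^ j * (offset N h (n + r) (n + r) - a) :=
      mul_le_mul (pow_le_pow_of_le_one hd0.le hd1 hjN) s1
        (mul_nonneg (by positivity) (by linarith)) (by positivity)
    have s4 := O.offset_ge hN hw hl₁.le hl₂ hev
      (fun m => O.offset_ge' hN hw hl₁.le hl₂
        (show n ≤ n + r + j * (N - 1) by omega) ha m) (n + r + j * (N - 1))
    have s5 : (1 - l₂) ^ (N * N) * (d ^ N * ((1 - l₂) ^ N * (1 / 2) * (b - a))) ≤
        (1 - l₂) ^ (n + N * N - (n + r + j * (N - 1))) *
          (offset N h (n + r + j * (N - 1)) (n + r + j * (N - 1)) - a) :=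
      mul_le_mul (pow_le_pow_of_le_one hq0.le hq1 (by omega)) (s3.trans s2)
        (mul_nonneg (by positivity) (mul_nonneg (by positivity) (by linarith))) (by positivity)
    rw [← O.offset_congr hN _ hlab]
    have e : C * (b - a) =
      (1 - l₂) ^ (N * N) * (d ^ N * ((1 - l₂) ^ N * (1 / 2) * (b - a))) := by rw [hC]; ring
    linarith

theorem tendsto_offset_of_forward (O : IsLiftedOrbit N ω₀ w l₁ l₂ h T) (hN : 2 ≤ N)
    (hω₀ : 0 < ω₀) (hw : 0 < w) (hl₁ : 0 < l₁) (hl₁' : l₁ < 1) (hl₂ : l₂ ∈ Set.Ico (0 : ℝ) 1) :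
    ∃ c, ∀ m, Tendsto (fun n => offset N h n m) atTop (𝓝 c) := by
  obtain ⟨κ, hκ0, hκ1, hκ⟩ := O.exists_contraction hN hω₀ hw hl₁ hl₁' hl₂
  obtain ⟨a, b, hab⟩ := O.exists_offset_bounds hN 0
  have hiter : ∀ k : ℕ, ∃ a' b', b' - a' ≤ κ ^ k * (b - a) ∧
      ∀ m, a' ≤ offset N h (k * (N * N)) m ∧ offset N h (k * (N * N)) m ≤ b' := by
    intro k
    induction k with
    | zero => exact ⟨a, b, by simp, by simpa using hab⟩
    | succ k ih =>
      obtain ⟨a₁, b₁, h1, h2⟩ := ih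
      obtain ⟨a₂, b₂, h3, h4⟩ := hκ _ a₁ b₁ h2
      refine ⟨a₂, b₂, h3.trans ?_, by rwa [show (k + 1) * (N * N) = k * (N * N) + N * N by ring]⟩
      rw [pow_succ]
      nlinarith
  have hsmall : ∀ ε > 0, ∃ n a' b', b' - a' < ε ∧
      ∀ n' ≥ n, ∀ m, a' ≤ offset N h n' m ∧ offset N h n' m ≤ b' := by
    intro ε hε
    have ht : Tendsto (fun k : ℕ => κ ^ k * (b - a)) atTop (𝓝 (0 * (b - a))) :=
      (tendsto_pow_atTop_nhds_zero_of_lt_one hκ0 hκ1).mul_const _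
    rw [zero_mul] at ht
    obtain ⟨k, hk⟩ := (ht.eventually (gt_mem_nhds hε)).exists
    obtain ⟨a', b', h1, h2⟩ := hiter k
    exact ⟨_, a', b', h1.trans_lt hk, fun n' hn' m =>
      ⟨O.offset_ge' hN hw hl₁.le hl₂ hn' (fun m => (h2 m).1) m,
        O.offset_le hN hw ⟨hl₁.le, hl₁'⟩ hl₂.1 hn' (fun m => (h2 m).2) m⟩⟩
  have hcauchy : CauchySeq fun n => offset N h n 0 := by
    refine Metric.cauchySeq_iff'.2 fun ε hε => ?_
    obtain ⟨n, a', b', h1, h2⟩ := hsmall ε hε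
    refine ⟨n, fun n' hn' => ?_⟩
    have e1 := h2 n le_rfl 0
    have e2 := h2 n' hn' 0
    rw [Real.dist_eq, abs_lt]
    constructor <;> linarith
  obtain ⟨c, hc⟩ := cauchySeq_tendsto_of_complete hcauchy
  refine ⟨c, fun m => ?_⟩
  have hdiff : Tendsto (fun n => offset N h n m - offset N h n 0) atTop (𝓝 0) := by
    refine Metric.tendsto_atTop.2 fun ε hε => ?_
    obtain ⟨n, a', b', h1, h2⟩ := hsmall ε hε
    refine ⟨n, fun n' hn' => ?_⟩
    have e1 := h2 n' hn' m
    have e2 := h2 n' hn' 0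
    rw [Real.dist_eq, abs_lt]
    constructor <;> linarith
  simpa using hdiff.add hc

end IsLiftedOrbit

/-! ### Convergence with backward coupling only -/

/-- A sequence that contracts by the factor `q` up to an error of order `ρ ^ k`, where `q < ρ`, is
itself of order `ρ ^ k`. -/
theorem exists_le_mul_pow_of_contraction {x : ℕ → ℝ} {q ρ C : ℝ} (hq : 0 ≤ q) (hρ : q < ρ)
    (hx : ∀ᶠ k in atTop, x (k + 1) ≤ q * x k + C * ρ ^ k) :
    ∃ C', ∀ᶠ k in atTop, x k ≤ C' * ρ ^ k := by
  obtain ⟨K, hK⟩ := eventually_atTop.1 hx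
  have hρ0 : 0 < ρ := hq.trans_lt hρ
  set C' := max (x K / ρ ^ K) (C / (ρ - q)) with hC'
  refine ⟨C', eventually_atTop.2 ⟨K, fun k hk => ?_⟩⟩
  have h1 : C ≤ C' * (ρ - q) := (div_le_iff₀ (by linarith)).1 (le_max_right _ _)
  induction k, hk using Nat.le_induction with
  | base => exact (div_le_iff₀ (pow_pos hρ0 K)).1 (le_max_left _ _)
  | succ k hk ih =>
    have h2 := hK k hk
    have h3 : 0 < ρ ^ k := pow_pos hρ0 k
    have h4 : q * x k ≤ q * (C' * ρ ^ k) := mul_le_mul_of_nonneg_left ih hq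
    have h5 : C * ρ ^ k ≤ C' * (ρ - q) * ρ ^ k := mul_le_mul_of_nonneg_right h1 h3.le
    rw [pow_succ]
    linarith

namespace IsLiftedOrbit

variable {N : ℕ} {ω₀ w l₂ : ℝ} {h : ℕ → ℕ → ℝ} {T : ℕ → ℝ} {Y : ℕ → ℝ}

theorem sub_congr {l₁ : ℝ} (O : IsLiftedOrbit N ω₀ w l₁ l₂ h T) (n n' r : ℕ) {m m' : ℕ}
    (hm : m % N = m' % N) : h n m - h n' (m + r) = h n m' - h n' (m' + r) := by
  have hper : Function.Periodic (fun m => h n m - h n' (m + r)) N := fun m => by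
    simp only
    rw [show m + N + r = m + r + N by ring, O.periodic, O.periodic]; ring
  have e1 := hper.map_mod_nat m
  have e2 := hper.map_mod_nat m'
  rw [hm] at e1
  exact e1.symm.trans e2

theorem backward_step (O : IsLiftedOrbit N ω₀ w 0 l₂ h T) (hN : 2 ≤ N) (hw : 0 < w)
    (hl₂ : 0 ≤ l₂) {n m r : ℕ} (hm : n % N = m % N) (hr1 : 1 ≤ r) (hrN : r ≤ N) :
    h n (m + r) - h (n + 1) (m + r) = min (w * (T (n + 1) - T n))
      (l₂ * max (2 * Real.pi / N - (h n m - h n (m + r))) 0) := by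
  have hs : 0 ≤ w * (T (n + 1) - T n) := by have := O.time_lt n; nlinarith
  have hpi := Real.pi_pos
  have hDpi := spacing_le_pi hN
  have e1 := O.sub_congr n (n + 1) 0 (m := m + r) (m' := n + r) (Nat.ModEq.add_right r hm.symm)
  have e2 := O.sub_congr n n r hm
  rw [add_zero, add_zero] at e1
  rw [e1, ← e2]
  have hf := O.fire n
  rcases hrN.eq_or_lt with rfl | hrN'
  · rw [O.step_base hN hw, O.periodic, max_eq_right (by linarith), mul_zero, min_eq_right hs,
      sub_self]
  · have hmax : 0 ≤ l₂ * max (2 * Real.pi / N - (h n n - h n (n + r))) 0 :=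
      mul_nonneg hl₂ (le_max_right _ _)
    rw [O.step n r hr1 hrN, phaseResponse_of_mem_Ioo hN (O.phase_pos hrN') (O.phase_lt hr1),
      zero_mul, zero_sub, show h n (n + r) + ω₀ * T n - (2 * Real.pi - 2 * Real.pi / N) =
        2 * Real.pi / N - (h n n - h n (n + r)) by linarith,
      partialShift_of_nonpos hs (by linarith), neg_neg]
    ring

theorem time_step_eq {l₁ : ℝ} (O : IsLiftedOrbit N ω₀ w l₁ l₂ h T) {n m : ℕ}
    (hm : n % N = m % N) : ω₀ * (T (n + 1) - T n) = h n m - h (n + 1) (m + 1) := by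
  rw [← O.sub_congr n (n + 1) 1 hm]
  have h1 := O.fire n
  have h2 := O.fire (n + 1)
  linarith

theorem backward_antitone (O : IsLiftedOrbit N ω₀ w 0 l₂ h T) (hN : 2 ≤ N) (hw : 0 < w)
    (hl₂ : 0 ≤ l₂) (m : ℕ) : Antitone fun n => h n m := by
  refine antitone_nat_of_succ_le fun n => ?_
  obtain ⟨r, hr1, hrN, hr⟩ := exists_label_mod_eq hN n m
  have e := O.sub_congr n (n + 1) 0 hr
  rw [add_zero, add_zero, O.backward_step hN hw hl₂ rfl hr1 hrN] at e
  have := O.time_lt n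
  have := le_min (show 0 ≤ w * (T (n + 1) - T n) by nlinarith)
    (mul_nonneg hl₂ (le_max_right (2 * Real.pi / N - (h n n - h n (n + r))) 0))
  linarith

theorem exists_backward_limit (O : IsLiftedOrbit N ω₀ w 0 l₂ h T) (hN : 2 ≤ N) (hw : 0 < w)
    (hl₂ : l₂ ∈ Set.Ico (0 : ℝ) 1) :
    ∃ Y : ℕ → ℝ, ∀ m, Tendsto (fun n => h n m) atTop (𝓝 (Y m)) := by
  obtain ⟨a, b, hab⟩ := O.exists_offset_bounds hN 0
  refine ⟨fun m => ⨅ n, h n m, fun m =>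
    tendsto_atTop_ciInf (O.backward_antitone hN hw hl₂.1 m) ⟨a - m * (2 * Real.pi / N), ?_⟩⟩
  rintro _ ⟨n, rfl⟩
  have := O.offset_ge' hN hw le_rfl hl₂ (Nat.zero_le n) (fun m => (hab m).1) m
  simp only [offset] at this ⊢
  linarith

theorem limit_periodic {l₁ : ℝ} (O : IsLiftedOrbit N ω₀ w l₁ l₂ h T)
    (hY : ∀ m, Tendsto (fun n => h n m) atTop (𝓝 (Y m))) (m : ℕ) :
    Y (m + N) = Y m - 2 * Real.pi := by
  refine tendsto_nhds_unique (hY (m + N)) ?_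
  simp only [O.periodic]
  exact (hY m).sub_const _

theorem limit_antitone {l₁ : ℝ} (O : IsLiftedOrbit N ω₀ w l₁ l₂ h T)
    (hY : ∀ m, Tendsto (fun n => h n m) atTop (𝓝 (Y m))) : Antitone Y := fun _ _ hm =>
  le_of_tendsto_of_tendsto' (hY _) (hY _) fun n => (O.strictAnti n).antitone hm

theorem limit_le (O : IsLiftedOrbit N ω₀ w 0 l₂ h T) (hN : 2 ≤ N) (hw : 0 < w)
    (hl₂ : 0 ≤ l₂) (hY : ∀ m, Tendsto (fun n => h n m) atTop (𝓝 (Y m))) (n m : ℕ) :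
    Y m ≤ h n m :=
  (O.backward_antitone hN hw hl₂ m).le_of_tendsto (hY m) n

/-- When label `n ≡ m` fires, label `m + 1` is the next to fire; the waiting time, and hence the
pushback that it receives, is at least proportional to its distance from label `m`. -/
theorem le_backward_drop (O : IsLiftedOrbit N ω₀ w 0 l₂ h T) (hN : 2 ≤ N) (hω₀ : 0 < ω₀)
    (hw : 0 < w) (hl₂ : 0 ≤ l₂) {n m : ℕ} (hm : n % N = m % N) :
    min (w / ω₀ * (h n m - h n (m + 1))) (l₂ * (2 * Real.pi / N - (h n m - h n (m + 1)))) ≤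
      h n (m + 1) - h (n + 1) (m + 1) := by
  rw [O.backward_step hN hw hl₂ hm le_rfl (by omega)]
  refine min_le_min ?_ (mul_le_mul_of_nonneg_left (le_max_left _ _) hl₂)
  have h1 := O.time_step_eq hm
  have h2 : h (n + 1) (m + 1) ≤ h n (m + 1) := O.backward_antitone hN hw hl₂ (m + 1) n.le_succ
  rw [div_mul_eq_mul_div, div_le_iff₀ hω₀]
  nlinarith

theorem limit_gap (O : IsLiftedOrbit N ω₀ w 0 l₂ h T) (hN : 2 ≤ N) (hω₀ : 0 < ω₀)
    (hw : 0 < w) (hl₂ : 0 < l₂) (hY : ∀ m, Tendsto (fun n => h n m) atTop (𝓝 (Y m))) (m : ℕ) :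
    Y m = Y (m + 1) ∨ 2 * Real.pi / N ≤ Y m - Y (m + 1) := by
  have hsub : Tendsto (fun k : ℕ => m + k * N) atTop atTop :=
    tendsto_atTop_mono (fun k => show k ≤ m + k * N by nlinarith) tendsto_id
  have hg : Tendsto (fun n => h n m - h n (m + 1)) atTop (𝓝 (Y m - Y (m + 1))) :=
    (hY m).sub (hY (m + 1))
  have h1 := ((hg.const_mul (w / ω₀)).min ((hg.const_sub (2 * Real.pi / N)).const_mul l₂)).comp
    hsub
  have h2 : Tendsto (fun n => h n (m + 1) - h (n + 1) (m + 1)) atTop (𝓝 (Y (m + 1) - Y (m + 1))) :=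
    (hY (m + 1)).sub ((hY (m + 1)).comp (tendsto_add_atTop_nat 1))
  have h3 := le_of_tendsto_of_tendsto' h1 (h2.comp hsub) fun k =>
    O.le_backward_drop hN hω₀ hw hl₂.le (by simp)
  rw [sub_self] at h3
  have h4 := O.limit_antitone hY m.le_succ
  rcases min_le_iff.1 h3 with h5 | h5
  · left
    have : Y m - Y (m + 1) ≤ 0 := nonpos_of_mul_nonpos_right h5 (by positivity)
    exact le_antisymm (by linarith) h4
  · right
    have := nonpos_of_mul_nonpos_right h5 hl₂
    linarith

/-- A label whose predecessor stays farther away than the desired spacing is not pushed back. -/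
theorem eventually_eq_limit (O : IsLiftedOrbit N ω₀ w 0 l₂ h T) (hN : 2 ≤ N)
    (hw : 0 < w) (hl₂ : 0 ≤ l₂) (hY : ∀ m, Tendsto (fun n => h n m) atTop (𝓝 (Y m))) {s : ℕ}
    (hs : 2 * Real.pi / N < Y s - Y (s + 1)) : ∀ᶠ n in atTop, h n (s + 1) = Y (s + 1) := by
  have hg : Tendsto (fun n => h n s - h n (s + 1)) atTop (𝓝 (Y s - Y (s + 1))) :=
    (hY s).sub (hY (s + 1))
  obtain ⟨n₀, hn₀⟩ := eventually_atTop.1 (hg.eventually (lt_mem_nhds hs))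
  have hstat : ∀ n ≥ n₀, h (n + 1) (s + 1) = h n (s + 1) := by
    intro n hn
    obtain ⟨r, hr1, hrN, hr⟩ := exists_label_mod_eq hN n (s + 1)
    have e := O.sub_congr n (n + 1) 0 hr
    rw [add_zero, add_zero, O.backward_step hN hw hl₂ rfl hr1 hrN] at e
    have hr' : (n + (r - 1)) % N = s % N := by
      refine Nat.ModEq.add_right_cancel' 1 (show n + (r - 1) + 1 ≡ s + 1 [MOD N] from ?_)
      rwa [show n + (r - 1) + 1 = n + r by omega]
    have e2 := O.sub_congr n n 1 hr'
    rw [show n + (r - 1) + 1 = n + r by omega] at e2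
    have h1 := (O.strictAnti n).antitone (show n ≤ n + (r - 1) by omega)
    have h2 := hn₀ n hn
    have := O.time_lt n
    rw [max_eq_right (by linarith), mul_zero, min_eq_right (by nlinarith)] at e
    linarith
  have hconst : ∀ n ≥ n₀, h n (s + 1) = h n₀ (s + 1) := by
    intro n hn
    induction n, hn using Nat.le_induction with
    | base => rfl
    | succ n hn ih => rw [hstat n hn, ih]
  have hlim : h n₀ (s + 1) = Y (s + 1) :=
    tendsto_nhds_unique (tendsto_const_nhds.congr' (eventually_atTop.2
      ⟨n₀, fun n hn => (hconst n hn).symm⟩)) (hY (s + 1))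
  exact eventually_atTop.2 ⟨n₀, fun n hn => (hconst n hn).trans hlim⟩

/-- If the limiting gap is the desired spacing, then over one round the excess of a label over its
limit follows the excess of its predecessor: eventually every pushback across the gap is completed
before the next pulse. -/
theorem eventually_excess_le (O : IsLiftedOrbit N ω₀ w 0 l₂ h T) (hN : 2 ≤ N) (hω₀ : 0 < ω₀)
    (hw : 0 < w) (hl₂ : l₂ ∈ Set.Ico (0 : ℝ) 1)
    (hY : ∀ m, Tendsto (fun n => h n m) atTop (𝓝 (Y m))) {s : ℕ}
    (hs : Y s - Y (s + 1) = 2 * Real.pi / N) :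
    ∀ᶠ n in atTop, h (n + N) (s + 1) - Y (s + 1) ≤
      (1 - l₂) * (h n (s + 1) - Y (s + 1)) + l₂ * (h n s - Y s) := by
  have hD := spacing_pos hN
  set D := 2 * Real.pi / N with hDd
  have hg : Tendsto (fun n => h n s - h n (s + 1)) atTop (𝓝 D) := by
    rw [← hs]; exact (hY s).sub (hY (s + 1))
  have hpos : 0 < w * D / (2 * ω₀) := by positivity
  obtain ⟨n₀, hn₀⟩ := eventually_atTop.1 ((hg.eventually (lt_mem_nhds (half_lt_self hD))).and
    (hg.eventually (lt_mem_nhds (show D - w * D / (2 * ω₀) < D by linarith))))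
  refine eventually_atTop.2 ⟨n₀, fun n hn => ?_⟩
  obtain ⟨r, hr1, hrN, hr⟩ := exists_label_mod_eq hN n (s + 1)
  have hr' : (n + (r - 1)) % N = s % N := by
    refine Nat.ModEq.add_right_cancel' 1 (show n + (r - 1) + 1 ≡ s + 1 [MOD N] from ?_)
    rwa [show n + (r - 1) + 1 = n + r by omega]
  set e := n + (r - 1) with he
  have anti := O.backward_antitone hN hw hl₂.1
  obtain ⟨g1, g2⟩ := hn₀ e (by omega)
  have hst := O.backward_step hN hw hl₂.1 hr' le_rfl (by omega)
  have htime := O.time_step_eq hr'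
  have a1 : h (e + 1) (s + 1) ≤ h e (s + 1) := anti (s + 1) e.le_succ
  have hwT : w * D / (2 * ω₀) ≤ w * (T (e + 1) - T e) := by
    rw [div_le_iff₀ (by positivity)]
    have : D / 2 ≤ ω₀ * (T (e + 1) - T e) := by linarith
    nlinarith
  have hmax : l₂ * max (D - (h e s - h e (s + 1))) 0 ≤ w * (T (e + 1) - T e) := by
    refine le_trans ?_ hwT
    have : max (D - (h e s - h e (s + 1))) 0 ≤ w * D / (2 * ω₀) := max_le (by linarith) hpos.le
    nlinarith [hl₂.1, hl₂.2]
  rw [min_eq_right hmax] at hst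
  have h1 := mul_le_mul_of_nonneg_left (le_max_left (D - (h e s - h e (s + 1))) 0) hl₂.1
  have a2 : h (n + N) (s + 1) ≤ h (e + 1) (s + 1) := anti (s + 1) (by omega)
  have a3 : h e (s + 1) ≤ h n (s + 1) := anti (s + 1) (by omega)
  have a4 : h e s ≤ h n s := anti s (by omega)
  have a5 := mul_le_mul_of_nonneg_left a3 (sub_nonneg.2 hl₂.2.le)
  have a6 := mul_le_mul_of_nonneg_left a4 hl₂.1
  rw [← hs] at h1 hst
  linarith

/-- Two neighbours cannot have the same limit if the label two places ahead of them is far away and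
the excess of the first of them decays at a rate below `(1 + w / ω₀) * (1 - l₂)`: in each round
their gap is multiplied by at least that number, as it shrinks at most by the factor `1 - l₂` when
the predecessor fires and is stretched by the factor `1 + w / ω₀` when the first of the two
fires. -/
theorem limit_ne_of_excess_le (O : IsLiftedOrbit N ω₀ w 0 l₂ h T) (hN : 2 ≤ N) (hω₀ : 0 < ω₀)
    (hw : 0 < w) (hl₂ : 0 < l₂) (hl₂' : l₂ < 1)
    (hY : ∀ m, Tendsto (fun n => h n m) atTop (𝓝 (Y m))) {s : ℕ} {C ρ : ℝ} (hρ0 : 0 < ρ)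
    (hρ : ρ < (1 + w / ω₀) * (1 - l₂)) (hfar : 2 * Real.pi / N < Y s - Y (s + 2))
    (hC : ∀ᶠ k in atTop, h (N * k) (s + 2) - Y (s + 2) ≤ C * ρ ^ k) : Y (s + 2) ≠ Y (s + 3) := by
  intro heq
  have hD := spacing_pos hN
  have hDpi := spacing_le_pi hN
  have hpi := Real.pi_pos
  have anti := O.backward_antitone hN hw hl₂.le
  set D := 2 * Real.pi / N with hDd
  have hκ : 0 < w / ω₀ := by positivity
  have hg : Tendsto (fun n => h n (s + 2) - h n (s + 3)) atTop (𝓝 0) := by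
    have := (hY (s + 2)).sub (hY (s + 3))
    rwa [heq, sub_self] at this
  have hg' : Tendsto (fun n => l₂ * (D - (h n (s + 2) - h n (s + 3))) -
      w / ω₀ * (h n (s + 2) - h n (s + 3))) atTop (𝓝 (l₂ * (D - 0) - w / ω₀ * 0)) :=
    ((hg.const_sub D).const_mul l₂).sub (hg.const_mul _)
  obtain ⟨n₀, hn₀⟩ := eventually_atTop.1
    ((((hY s).sub (hY (s + 2))).eventually (lt_mem_nhds hfar)).and
      (hg'.eventually (lt_mem_nhds (show 0 < l₂ * (D - 0) - w / ω₀ * 0 by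
        rw [sub_zero, mul_zero, sub_zero]; positivity))))
  have hs0 : ∀ n, 0 ≤ w * (T (n + 1) - T n) := fun n => by have := O.time_lt n; nlinarith
  -- The gap only shrinks at pulses of the predecessor `s + 1`.
  have keep : ∀ n ≥ n₀, ¬ n % N = (s + 1) % N → h (n + 1) (s + 2) = h n (s + 2) := by
    intro n hn hns
    obtain ⟨r, hr1, hrN, hr⟩ := exists_label_mod_eq hN n (s + 2)
    have hr2 : 2 ≤ r := by
      by_contra hlt
      obtain rfl : r = 1 := by omega
      exact hns (Nat.ModEq.add_right_cancel' 1 (show n + 1 ≡ s + 1 + 1 [MOD N] from hr))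
    have e := O.sub_congr n (n + 1) 0 hr
    rw [add_zero, add_zero, O.backward_step hN hw hl₂.le rfl hr1 hrN] at e
    have hr' : (n + (r - 2)) % N = s % N := by
      refine Nat.ModEq.add_right_cancel' 2 (show n + (r - 2) + 2 ≡ s + 2 [MOD N] from ?_)
      rwa [show n + (r - 2) + 2 = n + r by omega]
    have e2 := O.sub_congr n n 2 hr'
    rw [show n + (r - 2) + 2 = n + r by omega] at e2
    have h1 := (O.strictAnti n).antitone (show n ≤ n + (r - 2) by omega)
    have h2 := (hn₀ n hn).1
    rw [max_eq_right (by linarith), mul_zero, min_eq_right (hs0 n)] at e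
    linarith
  have grow : ∀ n ≥ n₀, ¬ n % N = (s + 1) % N →
      h n (s + 2) - h n (s + 3) ≤ h (n + 1) (s + 2) - h (n + 1) (s + 3) := by
    intro n hn hns
    have := anti (s + 3) n.le_succ
    simp only at this
    rw [keep n hn hns]; linarith
  have shrink : ∀ n, n % N = (s + 1) % N →
      (1 - l₂) * (h n (s + 2) - h n (s + 3)) ≤ h (n + 1) (s + 2) - h (n + 1) (s + 3) := by
    intro n hns
    have e1 := O.backward_step hN hw hl₂.le hns le_rfl (by omega)
    have e2 := O.backward_step hN hw hl₂.le hns one_le_two hN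
    rw [show s + 1 + 1 = s + 2 by ring] at e1
    rw [show s + 1 + 2 = s + 3 by ring] at e2
    have hlt : h n (s + 3) < h n (s + 2) := O.strictAnti n (by omega)
    have hmax : max (D - (h n (s + 1) - h n (s + 2))) 0 ≤
        max (D - (h n (s + 1) - h n (s + 3))) 0 + (h n (s + 2) - h n (s + 3)) :=
      max_le (by linarith [le_max_left (D - (h n (s + 1) - h n (s + 3))) 0])
        (by linarith [le_max_right (D - (h n (s + 1) - h n (s + 3))) 0])
    have hmax' := mul_le_mul_of_nonneg_left hmax hl₂.le
    have hmin : min (w * (T (n + 1) - T n)) (l₂ * max (D - (h n (s + 1) - h n (s + 2))) 0) ≤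
        min (w * (T (n + 1) - T n)) (l₂ * max (D - (h n (s + 1) - h n (s + 3))) 0) +
          l₂ * (h n (s + 2) - h n (s + 3)) := by
      have hp : 0 ≤ l₂ * (h n (s + 2) - h n (s + 3)) := mul_nonneg hl₂.le (by linarith)
      rw [← min_add_add_right]
      exact min_le_min (by linarith) (by linarith)
    linarith
  have stretch : ∀ n ≥ n₀, n % N = (s + 2) % N →
      (1 + w / ω₀) * (h n (s + 2) - h n (s + 3)) ≤ h (n + 1) (s + 2) - h (n + 1) (s + 3) := by
    intro n hn hns
    have hne : ¬ n % N = (s + 1) % N := by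
      intro hcon
      have h1 : 0 + (s + 1) ≡ 1 + (s + 1) [MOD N] := by
        rw [Nat.ModEq, zero_add, ← hcon, hns]; congr 1; ring
      have h2 : 0 % N = 1 % N := Nat.ModEq.add_right_cancel' _ h1
      rw [Nat.zero_mod, Nat.mod_eq_of_lt (by omega)] at h2
      omega
    rw [keep n hn hne]
    have h1 := O.le_backward_drop hN hω₀ hw hl₂.le hns
    rw [show s + 2 + 1 = s + 3 by ring, min_eq_left (by linarith [(hn₀ n hn).2])] at h1
    linarith
  set R := (1 + w / ω₀) * (1 - l₂) with hR
  have hR0 : 0 ≤ R := hρ0.le.trans hρ.le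
  have round : ∀ n ≥ n₀, n % N = (s + 1) % N →
      R * (h n (s + 2) - h n (s + 3)) ≤ h (n + N) (s + 2) - h (n + N) (s + 3) := by
    intro n hn hns
    have h1 := shrink n hns
    have hns' : (n + 1) % N = (s + 2) % N := Nat.ModEq.add_right 1 hns
    have h2 := stretch (n + 1) (by omega) hns'
    have h3 : ∀ j, j + 2 ≤ N → R * (h n (s + 2) - h n (s + 3)) ≤
        h (n + 2 + j) (s + 2) - h (n + 2 + j) (s + 3) := by
      intro j
      induction j with
      | zero =>
        intro _
        have := mul_le_mul_of_nonneg_left h1 (show 0 ≤ 1 + w / ω₀ by linarith)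
        rw [hR, add_zero, mul_assoc]
        exact this.trans h2
      | succ j ih =>
        intro hj
        refine (ih (by omega)).trans (grow (n + 2 + j) (by omega) fun hcon => ?_)
        have h4 : (j + 2) + n ≡ 0 + n [MOD N] := by
          rw [Nat.ModEq, zero_add, hns, ← hcon]; congr 1; ring
        have h5 : (j + 2) % N = 0 % N := Nat.ModEq.add_right_cancel' _ h4
        rw [Nat.zero_mod, Nat.mod_eq_of_lt (by omega)] at h5
        omega
    have := h3 (N - 2) (by omega)
    rwa [show n + 2 + (N - 2) = n + N by omega] at this
  set g₀ := h (s + 1 + N * n₀) (s + 2) - h (s + 1 + N * n₀) (s + 3) with hg₀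
  have hg₀pos : 0 < g₀ := sub_pos.2 (O.strictAnti _ (by omega))
  have lower : ∀ k, R ^ k * g₀ ≤
      h (s + 1 + N * (n₀ + k)) (s + 2) - h (s + 1 + N * (n₀ + k)) (s + 3) := by
    intro k
    induction k with
    | zero => simp [hg₀]
    | succ k ih =>
      have h1 := round (s + 1 + N * (n₀ + k)) (by nlinarith) (by simp)
      rw [show s + 1 + N * (n₀ + (k + 1)) = s + 1 + N * (n₀ + k) + N by ring, pow_succ]
      have := mul_le_mul_of_nonneg_left ih hR0
      linarith
  have upper : ∀ᶠ k in atTop, R ^ k * g₀ ≤ C * ρ ^ (n₀ + k) := by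
    filter_upwards [(tendsto_add_atTop_nat n₀).eventually hC] with k hk
    rw [add_comm k n₀] at hk
    have h1 : h (s + 1 + N * (n₀ + k)) (s + 2) ≤ h (N * (n₀ + k)) (s + 2) :=
      anti (s + 2) (by omega)
    have h2 := O.limit_le hN hw hl₂.le hY (s + 1 + N * (n₀ + k)) (s + 3)
    have h3 := lower k
    linarith
  have hbig : Tendsto (fun k : ℕ => (R / ρ) ^ k) atTop atTop :=
    tendsto_pow_atTop_atTop_of_one_lt ((one_lt_div hρ0).2 hρ)
  obtain ⟨k, hk1, hk2⟩ := (upper.and (hbig.eventually_gt_atTop (C * ρ ^ n₀ / g₀))).exists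
  rw [div_lt_iff₀ hg₀pos, div_pow, div_mul_eq_mul_div, lt_div_iff₀ (pow_pos hρ0 k)] at hk2
  rw [pow_add] at hk1
  linarith

theorem tendsto_offset_of_backward (O : IsLiftedOrbit N ω₀ w 0 l₂ h T) (hN : 2 ≤ N)
    (hω₀ : 0 < ω₀) (hw : 0 < w) (hl₂ : 0 < l₂) (hl₂' : l₂ < 1) :
    ∃ c, ∀ m, Tendsto (fun n => offset N h n m) atTop (𝓝 c) := by
  have hl : l₂ ∈ Set.Ico (0 : ℝ) 1 := ⟨hl₂.le, hl₂'⟩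
  obtain ⟨Y, hY⟩ := O.exists_backward_limit hN hw hl
  have hD := spacing_pos hN
  have hND := natCast_mul_spacing hN
  have hper := O.limit_periodic hY
  have hNc : ((N - 1 : ℕ) : ℝ) = N - 1 := by rw [Nat.cast_sub (by omega)]; simp
  set D := 2 * Real.pi / N with hDd
  have hκ : 0 < w / ω₀ := by positivity
  -- Any rate strictly between `1 - l₂` and `(1 + w / ω₀) * (1 - l₂)` will do.
  set ρ := (1 + w / ω₀ / 2) * (1 - l₂) with hρd
  have hρ1 : 1 - l₂ < ρ := by nlinarith
  have hρ0 : 0 < ρ := by linarith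
  have hρ2 : ρ < (1 + w / ω₀) * (1 - l₂) := by nlinarith
  have hNk : Tendsto (fun k : ℕ => N * k) atTop atTop :=
    tendsto_atTop_mono (fun k => show k ≤ N * k by nlinarith) tendsto_id
  have base : ∀ s, D < Y s - Y (s + 1) →
      ∃ C, ∀ᶠ k in atTop, h (N * k) (s + 1) - Y (s + 1) ≤ C * ρ ^ k := fun s hs => by
    refine ⟨0, ?_⟩
    filter_upwards [hNk.eventually (O.eventually_eq_limit hN hw hl₂.le hY hs)] with k hk
    rw [hk]; simp
  have step : ∀ s, D ≤ Y s - Y (s + 1) →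
      (∃ C, ∀ᶠ k in atTop, h (N * k) s - Y s ≤ C * ρ ^ k) →
      ∃ C, ∀ᶠ k in atTop, h (N * k) (s + 1) - Y (s + 1) ≤ C * ρ ^ k := by
    rintro s hs ⟨C, hC⟩
    rcases hs.eq_or_lt with hs | hs
    · refine exists_le_mul_pow_of_contraction (q := 1 - l₂) (C := l₂ * C) (by linarith) hρ1 ?_
      filter_upwards [hNk.eventually (O.eventually_excess_le hN hω₀ hw hl hY hs.symm), hC]
        with k h1 h2
      rw [show N * (k + 1) = N * k + N by ring]
      have := mul_le_mul_of_nonneg_left h2 hl₂.le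
      linarith
    · exact base s hs
  -- A gap wider than `D` makes all later gaps at least `D`, which is too much for one turn.
  have hle : ∀ m, Y m - Y (m + 1) ≤ D := by
    intro i
    by_contra! hi
    obtain ⟨s, hs⟩ : ∃ s, s + 1 = i + N := ⟨i + N - 1, by omega⟩
    have hs1 : D < Y (s + 1) - Y (s + 2) := by
      rw [show s + 2 = i + 1 + N by omega, hs, hper, hper]; linarith
    have hall : ∀ j, D ≤ Y (s + j + 1) - Y (s + j + 2) ∧ D < Y (s + j) - Y (s + j + 2) ∧
        ∃ C, ∀ᶠ k in atTop, h (N * k) (s + j + 2) - Y (s + j + 2) ≤ C * ρ ^ k := by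
      intro j
      induction j with
      | zero =>
        have := O.limit_antitone hY s.le_succ
        exact ⟨hs1.le, by simp only [add_zero]; linarith, base (s + 1) hs1⟩
      | succ j ih =>
        obtain ⟨h1, h2, C, hC⟩ := ih
        have h3 : D ≤ Y (s + j + 2) - Y (s + j + 3) :=
          (O.limit_gap hN hω₀ hw hl₂ hY (s + j + 2)).resolve_left
            (O.limit_ne_of_excess_le hN hω₀ hw hl₂ hl₂' hY hρ0 hρ2 h2 hC)
        rw [← add_assoc, show s + j + 1 + 1 = s + j + 2 by ring,
          show s + j + 1 + 2 = s + j + 3 by ring]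
        exact ⟨h3, by linarith, step (s + j + 2) h3 ⟨C, hC⟩⟩
    have hsum : ∀ j : ℕ, j * D ≤ Y (s + 2) - Y (s + 2 + j) := by
      intro j
      induction j with
      | zero => simp
      | succ j ih =>
        have := (hall (j + 1)).1
        rw [show s + (j + 1) + 1 = s + 2 + j by ring,
          show s + (j + 1) + 2 = s + 2 + (j + 1) by ring] at this
        push_cast; linarith
    have h1 := hsum (N - 1)
    have h2 := hper (s + 1)
    rw [show s + 2 + (N - 1) = s + 1 + N by omega, h2, hNc] at h1
    linarith
  have hge : ∀ m, D ≤ Y m - Y (m + 1) := by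
    intro m
    have hsum : ∀ j : ℕ, Y (m + 1) - Y (m + 1 + j) ≤ j * D := by
      intro j
      induction j with
      | zero => simp
      | succ j ih =>
        have := hle (m + 1 + j)
        rw [← add_assoc]; push_cast; linarith
    have h1 := hsum (N - 1)
    rw [show m + 1 + (N - 1) = m + N by omega, hper, hNc] at h1
    linarith
  have hconst : ∀ m : ℕ, Y m + m * D = Y 0 := by
    intro m
    induction m with
    | zero => simp
    | succ m ih =>
      have h1 := hle m
      have h2 := hge m
      push_cast; linarith
  refine ⟨Y 0, fun m => ?_⟩
  rw [← hconst m]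
  exact (hY m).add_const _

/-- All offsets of a lifted orbit converge to a common limit. -/
theorem tendsto_offset {l₁ : ℝ} (O : IsLiftedOrbit N ω₀ w l₁ l₂ h T) (hN : 2 ≤ N)
    (hω₀ : 0 < ω₀) (hw : 0 < w) (hl₁ : l₁ ∈ Set.Ico (0 : ℝ) 1) (hl₂ : l₂ ∈ Set.Ico (0 : ℝ) 1)
    (hl : ¬ (l₁ = 0 ∧ l₂ = 0)) :
    ∃ c, ∀ m, Tendsto (fun n => offset N h n m) atTop (𝓝 c) := by
  rcases hl₁.1.eq_or_lt with rfl | h1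
  · exact O.tendsto_offset_of_backward hN hω₀ hw
      (lt_of_le_of_ne hl₂.1 fun e => hl ⟨rfl, e.symm⟩) hl₂.2
  · exact O.tendsto_offset_of_forward hN hω₀ hw h1 hl₁.2 hl₂

end IsLiftedOrbit

/-! ### From pulse records to lifted orbits -/

/-- The state of the robots at the successive pulse times `T n`: the adjustments `adj n` that are
carried out from then on, the phases `ph n` and the headings `hd n`. It retains everything about an
evolution except its values strictly between the pulses. -/
structure IsPulseRecord (N : ℕ) (ω₀ w l₁ l₂ : ℝ) (θ₀ : Fin N → ℝ) (T : ℕ → ℝ)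
    (adj ph hd arr : ℕ → Fin N → ℝ) : Prop where
  time_zero : T 0 = 0
  time_lt : ∀ n, T n < T (n + 1)
  phase_zero : ∀ i, ph 0 i = θ₀ i
  heading_zero : ∀ i, hd 0 i = θ₀ i
  adjustment_zero : ∀ i, adj 0 i = 0
  phase_lt : ∀ n i, ph n i < 2 * Real.pi
  arrival_eq : ∀ n i, arr n i =
    ph n i + (ω₀ * (T (n + 1) - T n) + partialShift w (T (n + 1) - T n) (adj n i))
  arrival_le : ∀ n i, arr n i ≤ 2 * Real.pi
  exists_fires : ∀ n, ∃ i, arr n i = 2 * Real.pi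
  phase_fire : ∀ n i, arr n i = 2 * Real.pi → ph (n + 1) i = 0
  adjustment_fire : ∀ n i, arr n i = 2 * Real.pi → adj (n + 1) i = 0
  phase_receive : ∀ n i, arr n i ≠ 2 * Real.pi → ph (n + 1) i = arr n i
  adjustment_receive : ∀ n i, arr n i ≠ 2 * Real.pi →
    adj (n + 1) i = phaseResponse N l₁ l₂ (arr n i)
  heading_succ : ∀ n i, hd (n + 1) i = hd n i + partialShift w (T (n + 1) - T n) (adj n i)

section Lift

variable {N : ℕ} (hN : 2 ≤ N) (σ : Equiv.Perm (Fin N))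

/-- The robot named by the label `m`, when the robots are numbered through `σ`. -/
def robotOf (m : ℕ) : Fin N := σ ⟨m % N, Nat.mod_lt _ (by omega)⟩

/-- Headings unrolled to a sequence indexed by the labels, which drops by `2π` per turn. -/
noncomputable def liftHeading (θ : Fin N → ℝ) (m : ℕ) : ℝ :=
  θ (robotOf hN σ m) - (m / N : ℕ) * (2 * Real.pi)

theorem robotOf_add_self (m : ℕ) : robotOf hN σ (m + N) = robotOf hN σ m := by
  simp [robotOf]

theorem liftHeading_add_self (θ : Fin N → ℝ) (m : ℕ) :
    liftHeading hN σ θ (m + N) = liftHeading hN σ θ m - 2 * Real.pi := by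
  rw [liftHeading, liftHeading, robotOf_add_self, Nat.add_div_right m (by omega)]
  push_cast; ring

theorem robotOf_val (i : Fin N) : robotOf hN σ i.val = σ i := by
  simp [robotOf, Nat.mod_eq_of_lt i.isLt]

theorem liftHeading_val (θ : Fin N → ℝ) (i : Fin N) : liftHeading hN σ θ i.val = θ (σ i) := by
  rw [liftHeading, robotOf_val, Nat.div_eq_of_lt i.isLt]; simp

theorem exists_robotOf_eq (n : ℕ) (i : Fin N) : ∃ r < N, robotOf hN σ (n + r) = i := by
  obtain ⟨r, hr, h⟩ := exists_lt_label_mod_eq hN n (σ.symm i).val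
  refine ⟨r, hr, ?_⟩
  simp [robotOf, h, Nat.mod_eq_of_lt (σ.symm i).isLt]

end Lift

namespace IsPulseRecord

variable {N : ℕ} {ω₀ w l₁ l₂ : ℝ} {θ₀ : Fin N → ℝ} {T : ℕ → ℝ} {adj ph hd arr : ℕ → Fin N → ℝ}

/-- The robots keep their cyclic order and fire in the order of the labels: at the pulse time
`T n`, the phases of the robots with labels `n, …, n + N - 1`, of which label `n` is the next to
fire, are the lifted headings up to the common drift `ω₀ * T n`. The coupling strengths are read as
`0` before the first pulse, as no adjustment is carried out then. -/
theorem invariant (R : IsPulseRecord N ω₀ w l₁ l₂ θ₀ T adj ph hd arr) (hN : 2 ≤ N) (hw : 0 < w)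
    (hl₁ : l₁ ∈ Set.Ico (0 : ℝ) 1) (hl₂ : l₂ ∈ Set.Ico (0 : ℝ) 1)
    (hθ₀ : ∀ i, θ₀ i ∈ Set.Ico (0 : ℝ) (2 * Real.pi)) {σ : Equiv.Perm (Fin N)}
    (hσ : StrictAnti fun i => θ₀ (σ i)) (n : ℕ) :
    StrictAnti (liftHeading hN σ (hd n)) ∧
    (∀ r < N, ph n (robotOf hN σ (n + r)) = liftHeading hN σ (hd n) (n + r) + ω₀ * T n ∧
      0 ≤ ph n (robotOf hN σ (n + r)) ∧
      adj n (robotOf hN σ (n + r)) = phaseResponse N (if n = 0 then 0 else l₁)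
        (if n = 0 then 0 else l₂) (ph n (robotOf hN σ (n + r)))) ∧
    liftHeading hN σ (hd (n + 1)) n + ω₀ * T (n + 1) = 2 * Real.pi := by
  have hpi := Real.pi_pos
  -- The first two claims at `n` give the third one at `n` and the first two at `n + 1`.
  have main : ∀ n, (StrictAnti (liftHeading hN σ (hd n)) ∧
      (∀ r < N, ph n (robotOf hN σ (n + r)) = liftHeading hN σ (hd n) (n + r) + ω₀ * T n ∧
        0 ≤ ph n (robotOf hN σ (n + r)) ∧
        adj n (robotOf hN σ (n + r)) = phaseResponse N (if n = 0 then 0 else l₁)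
          (if n = 0 then 0 else l₂) (ph n (robotOf hN σ (n + r))))) →
      liftHeading hN σ (hd (n + 1)) n + ω₀ * T (n + 1) = 2 * Real.pi ∧
      StrictAnti (liftHeading hN σ (hd (n + 1))) ∧
      (∀ r < N, ph (n + 1) (robotOf hN σ (n + 1 + r)) =
          liftHeading hN σ (hd (n + 1)) (n + 1 + r) + ω₀ * T (n + 1) ∧
        0 ≤ ph (n + 1) (robotOf hN σ (n + 1 + r)) ∧
        adj (n + 1) (robotOf hN σ (n + 1 + r)) = phaseResponse N (if n + 1 = 0 then 0 else l₁)
          (if n + 1 = 0 then 0 else l₂) (ph (n + 1) (robotOf hN σ (n + 1 + r)))) := by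
    rintro n ⟨hanti, hph⟩
    set k₁ := if n = 0 then 0 else l₁ with hk₁
    set k₂ := if n = 0 then 0 else l₂ with hk₂
    have hk₁' : k₁ ∈ Set.Ico (0 : ℝ) 1 := by rw [hk₁]; split_ifs <;> simp [hl₁.1, hl₁.2]
    have hk₂' : k₂ ∈ Set.Ico (0 : ℝ) 1 := by rw [hk₂]; split_ifs <;> simp [hl₂.1, hl₂.2]
    have hs : 0 ≤ w * (T (n + 1) - T n) := by have := R.time_lt n; nlinarith
    have hmono := strictMonoOn_add_partialShift hN hk₁' hk₂' hs
    have hmem : ∀ r < N, ph n (robotOf hN σ (n + r)) ∈ Set.Ico 0 (2 * Real.pi) := fun r hr =>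
      ⟨(hph r hr).2.1, R.phase_lt n _⟩
    have hΦ : ∀ r < N, liftHeading hN σ (hd (n + 1)) (n + r) + ω₀ * T n =
        ph n (robotOf hN σ (n + r)) + partialShift w (T (n + 1) - T n)
          (phaseResponse N k₁ k₂ (ph n (robotOf hN σ (n + r)))) := by
      intro r hr
      obtain ⟨h1, -, h3⟩ := hph r hr
      rw [← h3, h1, liftHeading, R.heading_succ, liftHeading]; ring
    have harr : ∀ r < N, arr n (robotOf hN σ (n + r)) =
        liftHeading hN σ (hd (n + 1)) (n + r) + ω₀ * T (n + 1) := by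
      intro r hr
      have := hΦ r hr
      rw [R.arrival_eq, (hph r hr).2.2]
      linarith
    have hnew : StrictAnti (liftHeading hN σ (hd (n + 1))) := by
      refine strictAnti_of_window hN (liftHeading_add_self hN σ _) n fun r hr => ?_
      have h1 := hΦ r hr
      rcases Nat.lt_or_ge (r + 1) N with hr' | hr'
      · have h2 := hΦ (r + 1) hr'
        have h3 : ph n (robotOf hN σ (n + (r + 1))) < ph n (robotOf hN σ (n + r)) := by
          rw [(hph r hr).1, (hph (r + 1) hr').1]
          have := hanti (show n + r < n + (r + 1) by omega)
          linarith
        have h4 := hmono (hmem _ hr') (hmem _ hr) h3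
        simp only at h4
        rw [← add_assoc n r 1] at h2 h4
        linarith
      · rw [show n + r + 1 = n + N by omega, liftHeading_add_self]
        have h2 := hΦ 0 (by omega)
        have h3 := (add_partialShift_mem_Ico hN hk₁' hk₂' hs (hmem 0 (by omega))).2
        have h4 := (add_partialShift_mem_Ico hN hk₁' hk₂' hs (hmem r hr)).1
        rw [← h2] at h3
        rw [← h1] at h4
        rw [add_zero] at h3
        linarith
    have hfire : liftHeading hN σ (hd (n + 1)) n + ω₀ * T (n + 1) = 2 * Real.pi := by
      obtain ⟨i, hi⟩ := R.exists_fires n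
      obtain ⟨r, hr, rfl⟩ := exists_robotOf_eq hN σ n i
      rw [harr r hr] at hi
      have h1 := R.arrival_le n (robotOf hN σ (n + 0))
      rw [harr 0 (by omega), add_zero] at h1
      have h2 := hnew.antitone (show n ≤ n + r by omega)
      linarith
    refine ⟨hfire, hnew, fun r hr => ?_⟩
    simp only [Nat.add_eq_zero_iff, one_ne_zero, and_false, if_false]
    rcases Nat.lt_or_ge (r + 1) N with hr' | hr'
    · have h1 := harr (r + 1) hr'
      rw [show n + (r + 1) = n + 1 + r by ring] at h1
      have hne : arr n (robotOf hN σ (n + 1 + r)) ≠ 2 * Real.pi := by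
        rw [h1]
        have := hnew (show n < n + 1 + r by omega)
        exact ne_of_lt (by linarith)
      rw [R.phase_receive n _ hne, R.adjustment_receive n _ hne]
      refine ⟨h1, ?_, rfl⟩
      rw [h1]
      have h2 := hnew (show n + 1 + r < n + N by omega)
      rw [liftHeading_add_self] at h2
      linarith
    · obtain rfl : r = N - 1 := by omega
      have h1 := harr 0 (by omega)
      rw [add_zero, hfire] at h1
      rw [show n + 1 + (N - 1) = n + N by omega, robotOf_add_self, liftHeading_add_self,
        R.phase_fire n _ h1, R.adjustment_fire n _ h1, phaseResponse_zero hN]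
      exact ⟨by linarith, le_rfl, rfl⟩
  have hbase : StrictAnti (liftHeading hN σ (hd 0)) ∧
      (∀ r < N, ph 0 (robotOf hN σ (0 + r)) = liftHeading hN σ (hd 0) (0 + r) + ω₀ * T 0 ∧
        0 ≤ ph 0 (robotOf hN σ (0 + r)) ∧
        adj 0 (robotOf hN σ (0 + r)) = phaseResponse N (if 0 = 0 then 0 else l₁)
          (if 0 = 0 then 0 else l₂) (ph 0 (robotOf hN σ (0 + r)))) := by
    refine ⟨strictAnti_of_window hN (liftHeading_add_self hN σ _) 0 fun r hr => ?_,
      fun r hr => ⟨?_, ?_, ?_⟩⟩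
    · rw [zero_add]
      have h1 := liftHeading_val hN σ (hd 0) ⟨r, hr⟩
      simp only [R.heading_zero] at h1
      rw [h1]
      rcases Nat.lt_or_ge (r + 1) N with hr' | hr'
      · have h2 := liftHeading_val hN σ (hd 0) ⟨r + 1, hr'⟩
        simp only [R.heading_zero] at h2
        rw [h2]
        exact hσ (by simp)
      · have h2 := liftHeading_val hN σ (hd 0) ⟨0, by omega⟩
        simp only [R.heading_zero] at h2
        rw [show r + 1 = 0 + N by omega, liftHeading_add_self, h2]
        linarith [(hθ₀ (σ ⟨0, by omega⟩)).2, (hθ₀ (σ ⟨r, hr⟩)).1]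
    · rw [R.phase_zero, liftHeading, R.heading_zero, R.time_zero, zero_add, Nat.div_eq_of_lt hr]
      simp
    · rw [R.phase_zero]; exact (hθ₀ _).1
    · simp [R.adjustment_zero, phaseResponse_zero_zero]
  have hall : ∀ n, StrictAnti (liftHeading hN σ (hd n)) ∧
      (∀ r < N, ph n (robotOf hN σ (n + r)) = liftHeading hN σ (hd n) (n + r) + ω₀ * T n ∧
        0 ≤ ph n (robotOf hN σ (n + r)) ∧
        adj n (robotOf hN σ (n + r)) = phaseResponse N (if n = 0 then 0 else l₁)
          (if n = 0 then 0 else l₂) (ph n (robotOf hN σ (n + r)))) := by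
    intro n
    induction n with
    | zero => exact hbase
    | succ n ih => exact (main n ih).2
  exact ⟨(hall n).1, (hall n).2, (main n (hall n)).1⟩

/-- A pulse record gives a lifted orbit; its index starts at the first pulse. -/
theorem isLiftedOrbit (R : IsPulseRecord N ω₀ w l₁ l₂ θ₀ T adj ph hd arr) (hN : 2 ≤ N)
    (hw : 0 < w) (hl₁ : l₁ ∈ Set.Ico (0 : ℝ) 1) (hl₂ : l₂ ∈ Set.Ico (0 : ℝ) 1)
    (hθ₀ : ∀ i, θ₀ i ∈ Set.Ico (0 : ℝ) (2 * Real.pi)) {σ : Equiv.Perm (Fin N)}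
    (hσ : StrictAnti fun i => θ₀ (σ i)) :
    IsLiftedOrbit N ω₀ w l₁ l₂ (fun n => liftHeading hN σ (hd (n + 1))) (fun n => T (n + 1)) where
  periodic n m := liftHeading_add_self hN σ _ m
  strictAnti n := (R.invariant hN hw hl₁ hl₂ hθ₀ hσ (n + 1)).1
  time_lt n := R.time_lt (n + 1)
  fire n := (R.invariant hN hw hl₁ hl₂ hθ₀ hσ n).2.2
  step n r hr1 hrN := by
    obtain ⟨h1, -, h3⟩ := (R.invariant hN hw hl₁ hl₂ hθ₀ hσ (n + 1)).2.1 (r - 1) (by omega)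
    rw [show n + 1 + (r - 1) = n + r by omega] at h1 h3
    simp only [Nat.add_eq_zero_iff, one_ne_zero, and_false, if_false] at h3
    rw [← h1, ← h3, liftHeading, R.heading_succ, liftHeading]; ring

end IsPulseRecord

/-- Initial headings can be numbered in decreasing order. -/
theorem exists_perm_strictAnti {N : ℕ} {θ₀ : Fin N → ℝ} (hinj : Function.Injective θ₀) :
    ∃ σ : Equiv.Perm (Fin N), StrictAnti fun i => θ₀ (σ i) := by
  refine ⟨Tuple.sort fun i => -θ₀ i, ?_⟩
  have h1 : Monotone ((fun i => -θ₀ i) ∘ Tuple.sort fun i => -θ₀ i) := Tuple.monotone_sort _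
  have h2 : Antitone fun i => θ₀ (Tuple.sort (fun i => -θ₀ i) i) := fun i j hij =>
    neg_le_neg_iff.1 (h1 hij)
  exact h2.strictAnti_of_injective (hinj.comp (Equiv.injective _))

/-! ### Integrating the rate between pulses -/

theorem sign_mul_min_eq_partialShift {w s : ℝ} (hs : 0 ≤ w * s) (ψ : ℝ) :
    Real.sign ψ * min (w * s) |ψ| = partialShift w s ψ := by
  rcases lt_trichotomy ψ 0 with h | rfl | h
  · rw [Real.sign_of_neg h, abs_of_neg h, partialShift_of_nonpos hs h.le]; ring
  · simp [partialShift_zero_right hs]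
  · rw [Real.sign_of_pos h, abs_of_pos h, partialShift_of_nonneg hs h.le]; ring

theorem intervalIntegrable_controlRate (ω₀ w ψ a b : ℝ) :
    IntervalIntegrable (controlRate ω₀ w ψ) MeasureTheory.volume a b := by
  have h1 : controlRate ω₀ w ψ = fun s =>
      ω₀ + (Set.Iio (|ψ| / w)).indicator (fun _ => Real.sign ψ * w) s := by
    funext s
    by_cases hs : s < |ψ| / w
    · simp [controlRate, hs]
    · simp [controlRate, hs]
  rw [h1]
  refine intervalIntegrable_const.add ⟨?_, ?_⟩ <;>
  exact (MeasureTheory.integrableOn_const (by simp)).indicator measurableSet_Iio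

theorem integral_controlRate {ω₀ w ψ s : ℝ} (hw : 0 < w) (hs : 0 ≤ s) :
    ∫ u in (0 : ℝ)..s, controlRate ω₀ w ψ u = ω₀ * s + partialShift w s ψ := by
  have hτ : 0 ≤ |ψ| / w := by positivity
  have early : ∀ s, 0 ≤ s → s ≤ |ψ| / w →
      ∫ u in (0 : ℝ)..s, controlRate ω₀ w ψ u = s * (ω₀ + Real.sign ψ * w) := by
    intro s hs hsτ
    rw [intervalIntegral.integral_congr_Ioo_of_le (f := controlRate ω₀ w ψ)
      (g := fun _ => ω₀ + Real.sign ψ * w) hs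
      fun u hu => if_pos (hu.2.trans_le hsτ)]
    rw [intervalIntegral.integral_const, sub_zero, smul_eq_mul]
  rw [← sign_mul_min_eq_partialShift (mul_nonneg hw.le hs)]
  rcases le_total s (|ψ| / w) with h | h
  · rw [early s hs h, min_eq_left (by rw [le_div_iff₀ hw] at h; linarith)]; ring
  · rw [← intervalIntegral.integral_add_adjacent_intervals
      (intervalIntegrable_controlRate ω₀ w ψ 0 (|ψ| / w))
      (intervalIntegrable_controlRate ω₀ w ψ (|ψ| / w) s), early _ hτ le_rfl,
      intervalIntegral.integral_congr_Ioo_of_le (f := controlRate ω₀ w ψ)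
        (g := fun _ => ω₀) h
        fun u hu => if_neg (not_lt.2 hu.1.le),
      min_eq_right (by rw [div_le_iff₀ hw] at h; linarith)]
    simp only [intervalIntegral.integral_const, smul_eq_mul]
    field_simp
    ring

theorem abs_controlRate_sub_le {ω₀ w : ℝ} (hw : 0 ≤ w) (ψ s : ℝ) :
    |controlRate ω₀ w ψ s - ω₀| ≤ w := by
  unfold controlRate
  split_ifs
  · rw [add_sub_cancel_left, abs_mul, abs_of_nonneg hw]
    rcases Real.sign_apply_eq ψ with h | h | h <;> simp [h, hw]
  · simpa using hw

theorem intervalIntegrable_of_eq_controlRate {f : ℝ → ℝ} {ω₀ w ψ a b t : ℝ} (ha : a ≤ t)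
    (ht : t ≤ b) (hf : ∀ u, a ≤ u → u < b → f u = controlRate ω₀ w ψ (u - a)) :
    IntervalIntegrable f MeasureTheory.volume a t := by
  have h1 := (intervalIntegrable_controlRate ω₀ w ψ 0 (t - a)).comp_sub_right a
  rw [zero_add, sub_add_cancel] at h1
  refine h1.congr_uIoo fun u hu => ?_
  rw [Set.uIoo_of_le ha] at hu
  exact (hf u hu.1.le (hu.2.trans_le ht)).symm

theorem integral_of_eq_controlRate {f : ℝ → ℝ} {ω₀ w ψ a b t : ℝ} (hw : 0 < w) (ha : a ≤ t)
    (ht : t ≤ b) (hf : ∀ u, a ≤ u → u < b → f u = controlRate ω₀ w ψ (u - a)) :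
    ∫ u in a..t, f u = ω₀ * (t - a) + partialShift w (t - a) ψ := by
  rw [intervalIntegral.integral_congr_Ioo_of_le (g := fun u => controlRate ω₀ w ψ (u - a)) ha
    fun u hu => hf u hu.1.le (hu.2.trans_le ht),
    intervalIntegral.integral_comp_sub_right, sub_self, integral_controlRate hw (by linarith)]

/-- A phase that stays below the threshold until the time `b` does not exceed it at `b`. -/
theorem phase_le_of_lt {ω₀ w ψ x a b : ℝ} (hab : a < b)
    (hlt : ∀ t, a ≤ t → t < b → x + (ω₀ * (t - a) + partialShift w (t - a) ψ) < 2 * Real.pi) :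
    x + (ω₀ * (b - a) + partialShift w (b - a) ψ) ≤ 2 * Real.pi := by
  have hcont : Continuous fun t => x + (ω₀ * (t - a) + partialShift w (t - a) ψ) := by
    have := continuous_partialShift w ψ
    fun_prop
  refine le_of_tendsto (hcont.continuousWithinAt (s := Set.Iio b) (x := b)) ?_
  filter_upwards [Ioo_mem_nhdsLT hab] with t ht
  exact (hlt t ht.1.le ht.2).le

theorem exists_mem_Ico_of_tendsto {T : ℕ → ℝ} (h0 : T 0 = 0) (hT : Tendsto T atTop atTop) {t : ℝ}
    (ht : 0 ≤ t) : ∃ n, T n ≤ t ∧ t < T (n + 1) := by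
  have hex : ∃ n, t < T n := (hT.eventually_gt_atTop t).exists
  have hne : Nat.find hex ≠ 0 := fun h => by
    have := Nat.find_spec hex
    rw [h, h0] at this
    linarith
  obtain ⟨k, hk⟩ := Nat.exists_eq_succ_of_ne_zero hne
  refine ⟨k, not_lt.1 (Nat.find_min hex (by omega)), ?_⟩
  have := Nat.find_spec hex
  rwa [hk] at this

namespace HeadingEvolution

variable {N : ℕ} {ω₀ ωmax l₁ l₂ : ℝ} {θ₀ : Fin N → ℝ}
  (E : HeadingEvolution N ω₀ ωmax l₁ l₂ θ₀)

theorem pulseTime_nonneg (n : ℕ) : 0 ≤ E.pulseTime n := by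
  rw [← E.pulseTime_zero]
  exact E.pulseTime_strictMono.monotone (Nat.zero_le n)

theorem intervalIntegrable_rate (i : Fin N) {s t : ℝ} (hs : 0 ≤ s) (ht : 0 ≤ t) :
    IntervalIntegrable (E.rate i) MeasureTheory.volume s t := by
  have main : ∀ t, 0 ≤ t → IntervalIntegrable (E.rate i) MeasureTheory.volume 0 t := by
    intro t ht
    obtain ⟨n, h1, h2⟩ := exists_mem_Ico_of_tendsto E.pulseTime_zero E.pulseTime_tendsto ht
    have h3 : IntervalIntegrable (E.rate i) MeasureTheory.volume (E.pulseTime 0)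
        (E.pulseTime n) := IntervalIntegrable.trans_iterate fun k _ =>
      intervalIntegrable_of_eq_controlRate (E.pulseTime_strictMono k.lt_succ_self).le le_rfl
        (E.rate_eq k i)
    rw [E.pulseTime_zero] at h3
    exact h3.trans (intervalIntegrable_of_eq_controlRate h1 h2.le (E.rate_eq n i))
  exact (main s hs).symm.trans (main t ht)

theorem heading_sub (i : Fin N) {s t : ℝ} (hs : 0 ≤ s) (ht : 0 ≤ t) :
    E.heading i t - E.heading i s = ∫ u in s..t, (E.rate i u - ω₀) := by
  have hint : ∀ s t, 0 ≤ s → 0 ≤ t →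
      IntervalIntegrable (fun u => E.rate i u - ω₀) MeasureTheory.volume s t := fun s t hs ht =>
    (E.intervalIntegrable_rate i hs ht).sub intervalIntegrable_const
  rw [E.heading_eq i t ht, E.heading_eq i s hs, add_sub_add_left_eq_sub,
    intervalIntegral.integral_interval_sub_left (hint 0 t le_rfl ht) (hint 0 s le_rfl hs)]

theorem respectsRateConstraint (hω : 0 ≤ ωmax) : E.RespectsRateConstraint := by
  intro i s t hs ht
  rw [E.heading_sub i hs ht, ← Real.norm_eq_abs]
  refine intervalIntegral.norm_integral_le_of_norm_le_const fun u hu => ?_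
  have hu0 : 0 ≤ u := (le_min hs ht).trans hu.1.le
  obtain ⟨n, h1, h2⟩ := exists_mem_Ico_of_tendsto E.pulseTime_zero E.pulseTime_tendsto hu0
  rw [E.rate_eq n i u h1 h2, Real.norm_eq_abs]
  exact abs_controlRate_sub_le hω _ _

theorem heading_eq_add_partialShift (hω : 0 < ωmax) (n : ℕ) (i : Fin N) {t : ℝ}
    (h1 : E.pulseTime n ≤ t) (h2 : t ≤ E.pulseTime (n + 1)) :
    E.heading i t = E.heading i (E.pulseTime n) +
      partialShift ωmax (t - E.pulseTime n) (E.adjustment n i) := by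
  have h0 := E.pulseTime_nonneg n
  have h3 := E.heading_sub i h0 (h0.trans h1)
  rw [intervalIntegral.integral_sub (E.intervalIntegrable_rate i h0 (h0.trans h1))
    intervalIntegrable_const, integral_of_eq_controlRate hω h1 h2 (E.rate_eq n i),
    intervalIntegral.integral_const, smul_eq_mul] at h3
  linarith

theorem isPulseRecord (hω : 0 < ωmax) : IsPulseRecord N ω₀ ωmax l₁ l₂ θ₀ E.pulseTime
    E.adjustment (fun n i => E.phase i (E.pulseTime n)) (fun n i => E.heading i (E.pulseTime n))
    E.arrival := by
  have hlt : ∀ n, E.pulseTime n < E.pulseTime (n + 1) := fun n =>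
    E.pulseTime_strictMono n.lt_succ_self
  have harr : ∀ n i, E.arrival n i = E.phase i (E.pulseTime n) +
      (ω₀ * (E.pulseTime (n + 1) - E.pulseTime n) +
        partialShift ωmax (E.pulseTime (n + 1) - E.pulseTime n) (E.adjustment n i)) := fun n i => by
    rw [E.arrival_eq, integral_of_eq_controlRate hω (hlt n).le le_rfl (E.rate_eq n i)]
  exact
  { time_zero := E.pulseTime_zero
    time_lt := hlt
    phase_zero := fun i => by simp only [E.pulseTime_zero, E.phase_zero]
    heading_zero := fun i => by
      simp only [E.pulseTime_zero, E.heading_eq i 0 le_rfl, intervalIntegral.integral_same,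
        add_zero]
    adjustment_zero := E.adjustment_zero
    phase_lt := fun n i => E.phase_lt n i _ le_rfl (hlt n)
    arrival_eq := harr
    arrival_le := fun n i => by
      rw [harr]
      refine phase_le_of_lt (hlt n) fun t h1 h2 => ?_
      rw [← integral_of_eq_controlRate hω h1 h2.le (E.rate_eq n i), ← E.phase_eq n i t h1 h2]
      exact E.phase_lt n i t h1 h2
    exists_fires := E.exists_fires
    phase_fire := E.phase_fire
    adjustment_fire := E.adjustment_fire
    phase_receive := E.phase_receive
    adjustment_receive := E.adjustment_receive
    heading_succ := fun n i => E.heading_eq_add_partialShift hω n i (hlt n).le le_rfl }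

/-- Between two pulses a heading stays between its values at these pulses, so that it converges
once its values at the pulses do. -/
theorem tendsto_heading (hω : 0 < ωmax) {i : Fin N} {L : ℝ}
    (hL : Tendsto (fun n => E.heading i (E.pulseTime n)) atTop (𝓝 L)) :
    Tendsto (E.heading i) atTop (𝓝 L) := by
  refine tendsto_order.2 ⟨fun a ha => ?_, fun a ha => ?_⟩
  all_goals
    first
    | obtain ⟨n₀, hn₀⟩ := eventually_atTop.1 (hL.eventually (lt_mem_nhds ha))
    | obtain ⟨n₀, hn₀⟩ := eventually_atTop.1 (hL.eventually (gt_mem_nhds ha))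
    filter_upwards [eventually_ge_atTop (E.pulseTime n₀)] with t ht
    obtain ⟨n, h1, h2⟩ := exists_mem_Ico_of_tendsto E.pulseTime_zero E.pulseTime_tendsto
      ((E.pulseTime_nonneg n₀).trans ht)
    have hn : n₀ ≤ n := Nat.lt_succ_iff.1 (E.pulseTime_strictMono.lt_iff_lt.1 (ht.trans_lt h2))
    have h3 := hn₀ n hn
    have h4 := hn₀ (n + 1) (by omega)
    rw [E.heading_eq_add_partialShift hω n i (h1.trans h2.le) le_rfl] at h4
    rw [E.heading_eq_add_partialShift hω n i h1 h2.le]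
    have h5 := partialShift_mem_uIcc (ψ := E.adjustment n i) hω.le (sub_nonneg.2 h1)
      (sub_le_sub_right h2.le (E.pulseTime n))
    rcases Set.mem_uIcc.1 h5 with ⟨h6, h7⟩ | ⟨h6, h7⟩ <;> linarith

end HeadingEvolution

/-! ### Convergence of the headings -/

theorem tendsto_toIcoMod_of_mem_Ioo {f : ℝ → ℝ} {p d : ℝ} (hp : 0 < p) (hd : d ∈ Set.Ioo 0 p)
    (hf : Tendsto f atTop (𝓝 d)) : Tendsto (fun t => toIcoMod hp 0 (f t)) atTop (𝓝 d) := by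
  refine hf.congr' ?_
  filter_upwards [hf.eventually (Ioo_mem_nhds hd.1 hd.2)] with t ht
  exact ((toIcoMod_eq_self hp).2 (by rw [zero_add]; exact ⟨ht.1.le, ht.2⟩)).symm

namespace HeadingEvolution

theorem desynchronizes {N : ℕ} {ω₀ ωmax l₁ l₂ : ℝ} {θ₀ : Fin N → ℝ}
    (E : HeadingEvolution N ω₀ ωmax l₁ l₂ θ₀) (hN : 2 ≤ N) (hω₀ : 0 < ω₀) (hω : 0 < ωmax)
    (hl₁ : l₁ ∈ Set.Ico (0 : ℝ) 1) (hl₂ : l₂ ∈ Set.Ico (0 : ℝ) 1) (hl : ¬ (l₁ = 0 ∧ l₂ = 0))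
    (hθ₀ : ∀ i, θ₀ i ∈ Set.Ico (0 : ℝ) (2 * Real.pi)) (hinj : Function.Injective θ₀) :
    E.Desynchronizes := by
  have hpi := Real.pi_pos
  have hD := spacing_pos hN
  have hDpi := spacing_le_pi hN
  have hND := natCast_mul_spacing hN
  obtain ⟨σ, hσ⟩ := exists_perm_strictAnti hinj
  refine ⟨σ, hσ, ?_⟩
  obtain ⟨c, hc⟩ := ((E.isPulseRecord hω).isLiftedOrbit hN hω hl₁ hl₂ hθ₀ hσ).tendsto_offset
    hN hω₀ hω hl₁ hl₂ hl
  have hlim : ∀ i : Fin N, Tendsto (E.heading (σ i)) atTop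
      (𝓝 (c - (i : ℕ) * (2 * Real.pi / N))) := by
    intro i
    refine E.tendsto_heading hω ((tendsto_add_atTop_iff_nat 1).1 ?_)
    refine ((hc i).sub_const _).congr fun n => ?_
    rw [offset, liftHeading_val]; ring
  intro i
  have hsub := (hlim i).sub (hlim (finRotate N i))
  obtain ⟨k, rfl⟩ : ∃ k, N = k + 1 := ⟨N - 1, by omega⟩
  rcases eq_or_ne i (Fin.last k) with rfl | hi
  · have h1 : Tendsto (fun t => E.heading (σ (Fin.last k)) t -
        E.heading (σ (finRotate (k + 1) (Fin.last k))) t + 2 * Real.pi) atTop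
        (𝓝 (2 * Real.pi / (k + 1 : ℕ))) := by
      convert hsub.add_const (2 * Real.pi) using 2
      simp only [finRotate_last, Fin.val_zero, Fin.val_last]
      push_cast at hND ⊢
      linarith
    refine (tendsto_toIcoMod_of_mem_Ioo Real.two_pi_pos ⟨hD, by linarith⟩ h1).congr fun t => ?_
    rw [toIcoMod_add_right]
  · refine tendsto_toIcoMod_of_mem_Ioo Real.two_pi_pos ⟨hD, by linarith⟩ ?_
    convert hsub using 2
    rw [coe_finRotate_of_ne_last hi]
    push_cast; ring

end HeadingEvolution

/-! ### Existence of an evolution -/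

/-- From phases below the threshold, there is a first time at which some phase reaches it. -/
theorem exists_first_hitting_time {N : ℕ} (hN : 2 ≤ N) {ω₀ w : ℝ} (hω₀ : 0 < ω₀) (hw : 0 < w)
    (ph adj : Fin N → ℝ) (hph : ∀ i, ph i < 2 * Real.pi) :
    ∃ d > 0, (∀ i s, 0 ≤ s → s < d → ph i + (ω₀ * s + partialShift w s (adj i)) < 2 * Real.pi) ∧
      ∃ i, 2 * Real.pi ≤ ph i + (ω₀ * d + partialShift w d (adj i)) := by
  set S : Set ℝ := Set.Ici 0 ∩
    ⋃ i, {s | 2 * Real.pi ≤ ph i + (ω₀ * s + partialShift w s (adj i))} with hS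
  have hclosed : IsClosed S := by
    refine isClosed_Ici.inter (isClosed_iUnion_of_finite fun i => ?_)
    have := continuous_partialShift w (adj i)
    exact isClosed_le continuous_const (by fun_prop)
  have hbdd : BddBelow S := ⟨0, fun s hs => hs.1⟩
  have hne : S.Nonempty := by
    let i : Fin N := ⟨0, by omega⟩
    have h1 : Tendsto (fun s => ω₀ * s) atTop atTop := tendsto_id.const_mul_atTop hω₀
    obtain ⟨s, h2, h3⟩ := ((h1.eventually_ge_atTop (2 * Real.pi - ph i + |adj i|)).and
      (eventually_ge_atTop 0)).exists
    refine ⟨s, h3, Set.mem_iUnion.2 ⟨i, ?_⟩⟩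
    have h4 := neg_le_of_abs_le (abs_partialShift_le (ψ := adj i) (mul_nonneg hw.le h3))
    simp only [Set.mem_ofPred_eq]
    linarith
  have hmem := hclosed.csInf_mem hne hbdd
  obtain ⟨h0, h1⟩ := hmem
  obtain ⟨i, hi⟩ := Set.mem_iUnion.1 h1
  refine ⟨sInf S, lt_of_le_of_ne h0 fun h => ?_, fun j s hs hsd => ?_, i, hi⟩
  · rw [← h] at hi
    simp only [Set.mem_ofPred_eq, mul_zero, partialShift_zero_left, add_zero] at hi
    exact absurd hi (not_le.2 (hph i))
  · by_contra! hcon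
    exact absurd (csInf_le hbdd ⟨hs, Set.mem_iUnion.2 ⟨j, hcon⟩⟩) (not_le.2 hsd)

/-- The data of all robots right after a pulse. -/
structure PulseState (N : ℕ) where
  /-- The time of the pulse. -/
  time : ℝ
  /-- The adjustments carried out from then on. -/
  adjustment : Fin N → ℝ
  /-- The phases after the resets. -/
  phase : Fin N → ℝ
  /-- The headings. -/
  heading : Fin N → ℝ
  phase_lt : ∀ i, phase i < 2 * Real.pi

theorem exists_isPulseRecord {N : ℕ} (hN : 2 ≤ N) {ω₀ w : ℝ} (l₁ l₂ : ℝ) (hω₀ : 0 < ω₀)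
    (hw : 0 < w) {θ₀ : Fin N → ℝ} (hθ₀ : ∀ i, θ₀ i < 2 * Real.pi) :
    ∃ T adj ph hd arr, IsPulseRecord N ω₀ w l₁ l₂ θ₀ T adj ph hd arr ∧
      ∀ n i t, T n ≤ t → t < T (n + 1) →
        ph n i + (ω₀ * (t - T n) + partialShift w (t - T n) (adj n i)) < 2 * Real.pi := by
  classical
  -- A step of the recursion waits until the first phase reaches the threshold.
  choose d hd0 hdlt hdhit using fun S : PulseState N =>
    exists_first_hitting_time hN hω₀ hw S.phase S.adjustment S.phase_lt
  have hdle : ∀ S : PulseState N, ∀ i,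
      S.phase i + (ω₀ * d S + partialShift w (d S) (S.adjustment i)) ≤ 2 * Real.pi := by
    intro S i
    have := phase_le_of_lt (ω₀ := ω₀) (w := w) (ψ := S.adjustment i) (x := S.phase i) (hd0 S)
      fun t h1 h2 => by rw [sub_zero]; exact hdlt S i t h1 h2
    rwa [sub_zero] at this
  let arr : PulseState N → Fin N → ℝ := fun S i =>
    S.phase i + (ω₀ * d S + partialShift w (d S) (S.adjustment i))
  let next : PulseState N → PulseState N := fun S =>
    { time := S.time + d S
      adjustment := fun i =>
        if arr S i = 2 * Real.pi then 0 else phaseResponse N l₁ l₂ (arr S i)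
      phase := fun i => if arr S i = 2 * Real.pi then 0 else arr S i
      heading := fun i => S.heading i + partialShift w (d S) (S.adjustment i)
      phase_lt := fun i => by
        split_ifs with h
        · exact Real.two_pi_pos
        · exact lt_of_le_of_ne (hdle S i) h }
  let S : ℕ → PulseState N := fun n => next^[n] ⟨0, 0, θ₀, θ₀, hθ₀⟩
  have hS : ∀ n, S (n + 1) = next (S n) := fun n => Function.iterate_succ_apply' _ _ _
  have htime : ∀ n, (S (n + 1)).time - (S n).time = d (S n) := fun n => by
    rw [hS]; exact add_sub_cancel_left _ _
  refine ⟨fun n => (S n).time, fun n => (S n).adjustment, fun n => (S n).phase,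
    fun n => (S n).heading, fun n => arr (S n), ?_, ?_⟩
  · exact
    { time_zero := rfl
      time_lt := fun n => by have := htime n; have := hd0 (S n); linarith
      phase_zero := fun i => rfl
      heading_zero := fun i => rfl
      adjustment_zero := fun i => rfl
      phase_lt := fun n => (S n).phase_lt
      arrival_eq := fun n i => by rw [htime]
      arrival_le := fun n i => hdle (S n) i
      exists_fires := fun n => by
        obtain ⟨i, hi⟩ := hdhit (S n)
        exact ⟨i, le_antisymm (hdle (S n) i) hi⟩
      phase_fire := fun n i h => by rw [hS]; exact if_pos h
      adjustment_fire := fun n i h => by rw [hS]; exact if_pos h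
      phase_receive := fun n i h => by rw [hS]; exact if_neg h
      adjustment_receive := fun n i h => by rw [hS]; exact if_neg h
      heading_succ := fun n i => by rw [htime, hS] }
  · intro n i t h1 h2
    refine hdlt (S n) i _ (sub_nonneg.2 h1) ?_
    rw [← htime]
    linarith

theorem nonempty_headingEvolution {N : ℕ} (hN : 2 ≤ N) {ω₀ ωmax l₁ l₂ : ℝ} (hω₀ : 0 < ω₀)
    (hω : 0 < ωmax) (hl₁ : l₁ ∈ Set.Ico (0 : ℝ) 1) (hl₂ : l₂ ∈ Set.Ico (0 : ℝ) 1)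
    {θ₀ : Fin N → ℝ} (hθ₀ : ∀ i, θ₀ i ∈ Set.Ico (0 : ℝ) (2 * Real.pi))
    (hinj : Function.Injective θ₀) : Nonempty (HeadingEvolution N ω₀ ωmax l₁ l₂ θ₀) := by
  obtain ⟨T, adj, ph, hd, arr, R, hlt⟩ :=
    exists_isPulseRecord hN l₁ l₂ hω₀ hω fun i => (hθ₀ i).2
  obtain ⟨σ, hσ⟩ := exists_perm_strictAnti hinj
  have hT : Tendsto T atTop atTop := (tendsto_add_atTop_iff_nat 1).1
    ((R.isLiftedOrbit hN hω hl₁ hl₂ hθ₀ hσ).tendsto_time hN hω₀ hω hl₁ hl₂.1)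
  have hmono : StrictMono T := strictMono_nat_of_lt_succ R.time_lt
  -- The index of the last pulse up to the time `t`.
  let idx : ℝ → ℕ := fun t => sInf {n | t < T (n + 1)}
  have hidx : ∀ n t, T n ≤ t → t < T (n + 1) → idx t = n := by
    intro n t h1 h2
    refine le_antisymm (Nat.sInf_le h2) (le_csInf ⟨n, h2⟩ fun k hk => ?_)
    exact Nat.lt_succ_iff.1 (hmono.lt_iff_lt.1 (h1.trans_lt hk))
  let rate : Fin N → ℝ → ℝ := fun i t => controlRate ω₀ ωmax (adj (idx t) i) (t - T (idx t))
  let phase : Fin N → ℝ → ℝ := fun i t => ph (idx t) i +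
    (ω₀ * (t - T (idx t)) + partialShift ωmax (t - T (idx t)) (adj (idx t) i))
  have hrate : ∀ n i t, T n ≤ t → t < T (n + 1) →
      rate i t = controlRate ω₀ ωmax (adj n i) (t - T n) := fun n i t h1 h2 => by
    simp only [rate, hidx n t h1 h2]
  have hphase : ∀ n i t, T n ≤ t → t < T (n + 1) →
      phase i t = ph n i + (ω₀ * (t - T n) + partialShift ωmax (t - T n) (adj n i)) :=
    fun n i t h1 h2 => by simp only [phase, hidx n t h1 h2]
  have hphaseT : ∀ n i, phase i (T n) = ph n i := fun n i => by
    rw [hphase n i _ le_rfl (R.time_lt n), sub_self, partialShift_zero_left]; ring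
  exact ⟨
    { pulseTime := T
      adjustment := adj
      arrival := arr
      rate := rate
      phase := phase
      heading := fun i t => θ₀ i + ∫ u in (0 : ℝ)..t, (rate i u - ω₀)
      pulseTime_zero := R.time_zero
      pulseTime_strictMono := hmono
      pulseTime_tendsto := hT
      phase_zero := fun i => by
        have := hphaseT 0 i
        rwa [R.time_zero, R.phase_zero] at this
      adjustment_zero := R.adjustment_zero
      rate_eq := hrate
      phase_eq := fun n i t h1 h2 => by
        rw [hphaseT, hphase n i t h1 h2, integral_of_eq_controlRate hω h1 h2.le (hrate n i)]
      phase_lt := fun n i t h1 h2 => by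
        rw [hphase n i t h1 h2]; exact hlt n i t h1 h2
      arrival_eq := fun n i => by
        rw [hphaseT, R.arrival_eq,
          integral_of_eq_controlRate hω (R.time_lt n).le le_rfl (hrate n i)]
      exists_fires := R.exists_fires
      phase_fire := fun n i h => by rw [hphaseT]; exact R.phase_fire n i h
      adjustment_fire := R.adjustment_fire
      phase_receive := fun n i h => by rw [hphaseT]; exact R.phase_receive n i h
      adjustment_receive := R.adjustment_receive
      heading_eq := fun i t _ => rfl }⟩

end HeadingDesync

theorem mainTheorem1 (N : ℕ) (hN : 2 ≤ N) (ω₀ ωmax l₁ l₂ : ℝ) (hω₀ : 0 < ω₀)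
    (hωmax : 0 < ωmax) (hl₁ : l₁ ∈ Set.Ico (0 : ℝ) 1) (hl₂ : l₂ ∈ Set.Ico (0 : ℝ) 1)
    (hl : ¬ (l₁ = 0 ∧ l₂ = 0)) (θ₀ : Fin N → ℝ)
    (hθ₀ : ∀ i, θ₀ i ∈ Set.Ico (0 : ℝ) (2 * Real.pi)) (hinj : Function.Injective θ₀) :
    Nonempty (HeadingDesync.HeadingEvolution N ω₀ ωmax l₁ l₂ θ₀) ∧
    ∀ E : HeadingDesync.HeadingEvolution N ω₀ ωmax l₁ l₂ θ₀,
      E.RespectsRateConstraint ∧ E.Desynchronizes :=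
  ⟨HeadingDesync.nonempty_headingEvolution hN hω₀ hωmax hl₁ hl₂ hθ₀ hinj, fun E =>
    ⟨E.respectsRateConstraint hωmax.le, E.desynchronizes hN hω₀ hωmax hl₁ hl₂ hl hθ₀ hinj⟩⟩
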